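/- **Setting.** Let $\Lambda=\mathbb Z_L^D$ ($L\ge 1$) be the periodic $D$-dimensional cubic lattice with the $\ell_\infty$-distance, each site carrying a finite number of qubits. A *cube of linear size* $r$ is a set $\{c+v : 0\le v_i\le r\}$; an *elementary cube* has linear size $1$. Let $H=-\sum_{a=1}^M G_a$ be a frustration-free stabilizer Hamiltonian on $\Lambda$: the $G_a$ are pairwise commuting signed multi-qubit Pauli operators, and each $G_a$ is located at, and supported on the vertices of, an elementary cube (several generators may share a cube; no translation invariance is assumed). Let $\mathcal G$ be the group generated by the $G_a$. Up to phases, elements of $\mathcal G$ are called stabilizers. The *syndrome* caused by a Pauli operator $E$ is the set of all $G_a$ that anticommute with $E$; its elements are called *defects*. $E$ *creates* $S$ from the vacuum if its syndrome is $S$. A *logical operator* is a Pauli operator with empty syndrome that is not a stabilizer. A set of defects is enclosed by (contained in) a cube if all elementary cubes occupied by its defects are. Fix a length scale $L_{tqo}$. A cluster (set of defects) $S$ is *neutral* if it is the syndrome of a Pauli operator whose support can be enclosed by a cube of linear size $L_{tqo}$; otherwise it is *charged*. * **TQO1**: every Pauli operator with empty syndrome whose support can be enclosed by a cube of linear size $L_{tqo}$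 is a stabilizer. * **TQO2**: every neutral cluster $S$ is the syndrome of a Pauli operator supported on the $1$-neighborhood of a smallest cube enclosing $S$. * **No-strings rule with constant $\alpha\ge 1$**: let $A_1,A_2$ be cubes of linear size $w$, and let $E$ be a Pauli operator whose support can be enclosed by a cube of linear size $L_{tqo}$ and such that every defect of its syndrome is contained in $A_1$ or in $A_2$. If the defects contained in one of $A_1$, $A_2$ form a charged cluster, then the distance between $A_1$ and $A_2$ is at most $\alpha w$. An *error path* is a finite sequence $E_1,\dots,E_T$ of single-qubit Pauli errors $\sigma^x,\sigma^y,\sigma^z$; it implements $E_T\cdots E_1$, and its intermediate syndromes are those of $E_t\cdots E_1$, $0\le t\le T$. A logical operator $\overline P$ (respectively a syndrome $S$) *has energy barrier* $\omega$ if every error path that implements $\overline P$ up to stabilizers (respectively creates $S$ from the vacuum) has an intermediate syndrome with more than $\omega$ defects. **Theorem.** 1. For all $\alpha\ge 1$ and $0<\gamma\le 1$ there is a constant $c=c(\alpha,\gamma)>0$ such that for all $D$, $L$, $L_{tqo}\ge L^\gamma$, and every such Hamiltonian satisfying TQO1, TQO2 and the no-strings rule with constant $\alpha$, every logical operator has energy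 barrier $c\log L$. 2. For every $\alpha\ge 1$ there is a constant $c=c(\alpha)>0$ such that for all $D$, $L$, $L_{tqo}$, and every such Hamiltonian satisfying TQO1, TQO2 and the no-strings rule with constant $\alpha$, the following holds. Let $S$ be a neutral cluster containing a charged cluster $S'\subseteq S$ such that $S'$ can be enclosed by a cube of linear size $r$, and no defect of $S\setminus S'$ is within distance $R>0$ from $S'$. If $r+R<L_{tqo}$, then $S$ has energy barrier $c\log R$. -/

import Mathlib

noncomputable section

namespace NoStrings

/-! ### Pauli operators -/

/-- A multi-qubit Pauli operator up to phase on a set `Q` of qubits: at each qubit a pair `(x, z)`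
of bits, where `(0,0)`, `(1,0)`, `(1,1)`, `(0,1)` stand for `I`, `X`, `Y`, `Z`.  Addition of labels
is multiplication of Pauli operators up to phase (see `exists_phase_toMatrix_mul`). -/
abbrev Pauli (Q : Type) : Type := Q → ZMod 2 × ZMod 2

/-- The single-qubit Pauli matrices. -/
def pauliMatrix (p : ZMod 2 × ZMod 2) : Matrix (Fin 2) (Fin 2) ℂ :=
  if p.1 = 0 then
    if p.2 = 0 then 1 else !![1, 0; 0, -1]
  else
    if p.2 = 0 then !![0, 1; 1, 0] else !![0, -Complex.I; Complex.I, 0]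

/-- The operator `⨂_q P_q` on the Hilbert space `(ℂ²)^{⊗ Q}`, as a matrix in the computational
basis, which is indexed by the bit strings `Q → Fin 2`. -/
def Pauli.toMatrix {Q : Type} [Fintype Q] (P : Pauli Q) : Matrix (Q → Fin 2) (Q → Fin 2) ℂ :=
  fun i j => ∏ q, pauliMatrix (P q) (i q) (j q)

theorem exists_phase_pauliMatrix_mul (p p' : ZMod 2 × ZMod 2) :
    ∃ c : ℂ, ‖c‖ = 1 ∧ pauliMatrix p * pauliMatrix p' = c • pauliMatrix (p + p') := by
  have h11 : (1 : ZMod 2) + 1 = 0 := by decide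
  have key : ∀ a : ZMod 2, a = 0 ∨ a = 1 := by decide
  obtain ⟨a, b⟩ := p
  obtain ⟨a', b'⟩ := p'
  rcases key a with rfl | rfl <;> rcases key b with rfl | rfl <;>
    rcases key a' with rfl | rfl <;> rcases key b' with rfl | rfl <;>
    first
    | (refine ⟨1, by simp, ?_⟩; ext i j; fin_cases i <;> fin_cases j <;>
        simp [pauliMatrix, Matrix.mul_apply, Fin.sum_univ_two, h11]; done)
    | (refine ⟨-1, by simp, ?_⟩; ext i j; fin_cases i <;> fin_cases j <;>
        simp [pauliMatrix, Matrix.mul_apply, Fin.sum_univ_two, h11]; done)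
    | (refine ⟨Complex.I, by simp, ?_⟩; ext i j; fin_cases i <;> fin_cases j <;>
        simp [pauliMatrix, Matrix.mul_apply, Fin.sum_univ_two, h11]; done)
    | (refine ⟨-Complex.I, by simp, ?_⟩; ext i j; fin_cases i <;> fin_cases j <;>
        simp [pauliMatrix, Matrix.mul_apply, Fin.sum_univ_two, h11]; done)

/-- Addition of labels is the product of Pauli operators up to phase. -/
theorem exists_phase_toMatrix_mul {Q : Type} [Fintype Q] [DecidableEq Q] (P P' : Pauli Q) :
    ∃ c : ℂ, ‖c‖ = 1 ∧ P.toMatrix * P'.toMatrix = c • Pauli.toMatrix (P + P') := by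
  choose c hc h using fun q => exists_phase_pauliMatrix_mul (P q) (P' q)
  refine ⟨∏ q, c q, by simp [norm_prod, hc], ?_⟩
  ext i j
  have h2 : ∀ q, ∑ k : Fin 2, pauliMatrix (P q) (i q) k * pauliMatrix (P' q) k (j q)
      = c q * pauliMatrix (P q + P' q) (i q) (j q) := by
    intro q
    have := congrFun (congrFun (h q) (i q)) (j q)
    simpa [Matrix.mul_apply] using this
  simp only [Matrix.mul_apply, Pauli.toMatrix, Matrix.smul_apply, smul_eq_mul, Pi.add_apply,
    ← Finset.prod_mul_distrib, ← h2]
  rw [Finset.prod_univ_sum]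
  simp [Fintype.piFinset_univ]

/-- `E` is a single-qubit error `σ^x`, `σ^y` or `σ^z`. -/
def IsSingleQubit {Q : Type} [DecidableEq Q] (E : Pauli Q) : Prop :=
  ∃ (q : Q) (p : ZMod 2 × ZMod 2), p ≠ 0 ∧ E = Pi.single q p

/-! ### The periodic lattice -/

/-- The sites of the `D`-dimensional cubic lattice of linear size `L` with periodic boundary
conditions. -/
abbrev Lattice (D L : ℕ) : Type := Fin D → ZMod L

/-- The `ℓ_∞` distance on the periodic lattice. -/
def torusDist {D L : ℕ} (u v : Lattice D L) : ℕ :=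
  Finset.univ.sup fun i => (u i - v i).valMinAbs.natAbs

/-- The cube of linear size `r` with corner `c`: all sites `c + v` with `0 ≤ v_i ≤ r`. -/
def cube {D L : ℕ} (c : Lattice D L) (r : ℝ) : Set (Lattice D L) :=
  {u | ∀ i, ((u i - c i).val : ℝ) ≤ r}

/-- The `r`-neighborhood of a set of sites. -/
def nbhd {D L : ℕ} (r : ℕ) (A : Set (Lattice D L)) : Set (Lattice D L) :=
  {u | ∃ v ∈ A, torusDist u v ≤ r}

/-! ### Stabilizer Hamiltonians -/

/-- The qubits, when the site `u` carries `n u` of them. -/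
abbrev Qubit {D L : ℕ} (n : Lattice D L → ℕ) : Type := (u : Lattice D L) × Fin (n u)

/-- The set of sites on which a Pauli operator acts nontrivially. -/
def support {D L : ℕ} {n : Lattice D L → ℕ} (E : Pauli (Qubit n)) : Set (Lattice D L) :=
  {u | ∃ k, E ⟨u, k⟩ ≠ 0}

/-- A frustration-free stabilizer Hamiltonian `H = -∑ a, G_a` on the periodic lattice, with
`G_a = sign a • gen a`, each generator being supported on the vertices of an elementary cube (the
cube of linear size `1` with corner `loc a`).  Several generators may share an elementary cube. -/
structure StabilizerHamiltonian (D L : ℕ) [NeZero L] where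
  /-- number of qubits at each site -/
  numQubits : Lattice D L → ℕ
  /-- number of generators -/
  M : ℕ
  /-- the Pauli operators underlying the generators -/
  gen : Fin M → Pauli (Qubit numQubits)
  /-- the signs of the generators -/
  sign : Fin M → ℤˣ
  /-- the elementary cube at which a generator is located -/
  loc : Fin M → Lattice D L
  support_gen : ∀ a, support (gen a) ⊆ cube (loc a) 1
  commute : ∀ a b, Commute (((sign a : ℤ) : ℂ) • (gen a).toMatrix)
    (((sign b : ℤ) : ℂ) • (gen b).toMatrix)
  frustrationFree : ∃ ψ : (Qubit numQubits → Fin 2) → ℂ, ψ ≠ 0 ∧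
    ∀ a, (((sign a : ℤ) : ℂ) • (gen a).toMatrix).mulVec ψ = ψ

namespace StabilizerHamiltonian

variable {D L : ℕ} [NeZero L] (H : StabilizerHamiltonian D L)

/-- The Pauli operators (up to phase) on the qubits of `H`. -/
abbrev Op : Type := Pauli (Qubit H.numQubits)

/-- The generator `G_a` as an operator. -/
def term (a : Fin H.M) : Matrix (Qubit H.numQubits → Fin 2) (Qubit H.numQubits → Fin 2) ℂ :=
  ((H.sign a : ℤ) : ℂ) • (H.gen a).toMatrix

/-- The Hamiltonian `H = -∑ a, G_a`. -/
def hamiltonian : Matrix (Qubit H.numQubits → Fin 2) (Qubit H.numQubits → Fin 2) ℂ :=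
  -∑ a, H.term a

open Classical in
/-- The syndrome caused by `E`: the set of generators flipped by `E`, i.e. anticommuting with it.
Its elements are the defects. -/
def syndrome (E : H.Op) : Finset (Fin H.M) :=
  Finset.univ.filter fun a => H.term a * E.toMatrix = -(E.toMatrix * H.term a)

/-- `E` belongs, up to phase, to the group generated by the `G_a` (as `G_a² = 1`, the group and the
monoid they generate coincide). -/
def IsStabilizer (E : H.Op) : Prop :=
  ∃ c : ℂ, ‖c‖ = 1 ∧ c • E.toMatrix ∈ Submonoid.closure (Set.range H.term)

/-- A logical operator creates no defects and is not a stabilizer. -/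
def IsLogical (P : H.Op) : Prop :=
  H.syndrome P = ∅ ∧ ¬ H.IsStabilizer P

/-- The union of the elementary cubes occupied by a set of defects. -/
def region (S : Finset (Fin H.M)) : Set (Lattice D L) :=
  ⋃ a ∈ S, cube (H.loc a) 1

/-- The support of `E` can be enclosed by a cube of linear size `ℓ`. -/
def Fits (ℓ : ℝ) (E : H.Op) : Prop :=
  ∃ c, support E ⊆ cube c ℓ

/-- A cluster `S` is neutral, at the length scale `ℓ = L_tqo`, if it can be created from the vacuum,
without any other defects, by a Pauli operator that fits in a cube of linear size `ℓ`.  Otherwise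
it is charged. -/
def Neutral (ℓ : ℝ) (S : Finset (Fin H.M)) : Prop :=
  ∃ E : H.Op, H.Fits ℓ E ∧ H.syndrome E = S

/-- TQO1 at the length scale `ℓ = L_tqo`. -/
def TQO1 (ℓ : ℝ) : Prop :=
  ∀ E : H.Op, H.syndrome E = ∅ → H.Fits ℓ E → H.IsStabilizer E

/-- The cube of linear size `r` with corner `c` is a smallest cube that encloses `S`. -/
def IsSmallestCube (S : Finset (Fin H.M)) (c : Lattice D L) (r : ℕ) : Prop :=
  H.region S ⊆ cube c r ∧ ∀ (c' : Lattice D L) (r' : ℕ), H.region S ⊆ cube c' r' → r ≤ r'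

/-- TQO2 at the length scale `ℓ = L_tqo`: a neutral cluster can be created by a Pauli operator
supported on the `1`-neighborhood of a smallest cube that encloses it. -/
def TQO2 (ℓ : ℝ) : Prop :=
  ∀ S : Finset (Fin H.M), H.Neutral ℓ S →
    ∃ (c : Lattice D L) (r : ℕ), H.IsSmallestCube S c r ∧
      ∃ E : H.Op, support E ⊆ nbhd 1 (cube c r) ∧ H.syndrome E = S

open Classical in
/-- The defects created by `E` that are contained in `A`. -/
def defectsIn (E : H.Op) (A : Set (Lattice D L)) : Finset (Fin H.M) :=
  (H.syndrome E).filter fun a => cube (H.loc a) 1 ⊆ A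

/-- `E` is a string segment of width `w` with anchor regions the cubes of linear size `w` with
corners `c₁` and `c₂`: a local Pauli operator (on the finite lattice: one that fits in a cube of
linear size `ℓ = L_tqo`) all of whose defects are contained in one of the two anchor regions. -/
def IsStringSegment (ℓ : ℝ) (w : ℕ) (c₁ c₂ : Lattice D L) (E : H.Op) : Prop :=
  H.Fits ℓ E ∧
    ∀ a ∈ H.syndrome E, cube (H.loc a) 1 ⊆ cube c₁ w ∨ cube (H.loc a) 1 ⊆ cube c₂ w

/-- A string segment is nontrivial if the cluster in one of its anchor regions is charged. -/
def IsNontrivialSegment (ℓ : ℝ) (w : ℕ) (c₁ c₂ : Lattice D L) (E : H.Op) : Prop :=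
  ¬ H.Neutral ℓ (H.defectsIn E (cube c₁ w)) ∨ ¬ H.Neutral ℓ (H.defectsIn E (cube c₂ w))

/-- The no-strings rule with constant `α`: the length of a nontrivial string segment of width `w`,
i.e. the distance between its anchor regions, is at most `α * w`. -/
def NoStringsRule (ℓ α : ℝ) : Prop :=
  ∀ (w : ℕ) (c₁ c₂ : Lattice D L) (E : H.Op), H.IsStringSegment ℓ w c₁ c₂ E →
    H.IsNontrivialSegment ℓ w c₁ c₂ E →
      ∃ u ∈ cube c₁ (w : ℝ), ∃ v ∈ cube c₂ (w : ℝ), (torusDist u v : ℝ) ≤ α * w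

/-- An error path: a finite sequence `E_1, …, E_T` of single-qubit Pauli errors.  It implements
`E_T ⋯ E_1`, whose label is the sum of the list. -/
def IsErrorPath (errs : List H.Op) : Prop :=
  ∀ E ∈ errs, IsSingleQubit E

/-- One of the states `ψ(t) = E_t ⋯ E_1 ψ₀`, `0 ≤ t ≤ T`, of the path has more than `ω` defects. -/
def Exceeds (errs : List H.Op) (ω : ℝ) : Prop :=
  ∃ t ≤ errs.length, ω < ((H.syndrome (errs.take t).sum).card : ℝ)

/-- The logical operator `P` has energy barrier `ω`: every error path that implements `P` on the
ground space, i.e. whose product is `P` up to a stabilizer, exceeds `ω` defects. -/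
def LogicalHasBarrier (P : H.Op) (ω : ℝ) : Prop :=
  ∀ errs : List H.Op, H.IsErrorPath errs → H.IsStabilizer (errs.sum + P) → H.Exceeds errs ω

/-- The syndrome `S` has energy barrier `ω`: every error path that creates `S` from the vacuum
exceeds `ω` defects. -/
def SyndromeHasBarrier (S : Finset (Fin H.M)) (ω : ℝ) : Prop :=
  ∀ errs : List H.Op, H.IsErrorPath errs → H.syndrome errs.sum = S → H.Exceeds errs ω

/-- No defect of `S` outside `S'` is within distance `R` from `S'`. -/
def IsIsolated (S S' : Finset (Fin H.M)) (R : ℝ) : Prop :=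
  ∀ u ∈ H.region S', ∀ v ∈ H.region (S \ S'), R < (torusDist u v : ℝ)

end StabilizerHamiltonian

end NoStrings

end

/-! The proof renormalizes the error path. Suppose every intermediate syndrome has at most `n`
defects. Take scales `ξ_q = (1200 * α) ^ q`. A syndrome is sparse at level `q` if no two of its
defects lie at a distance in `(4 ξ_q, ξ_(q+1)]`. Each level that fails allows two clusters of
defects to be merged, so a syndrome with at most `n` defects is sparse at some level below `n`
(`exists_sparseAt`).

Syndromes are then eliminated from the path level by level (`Topological.localizedOn_path`). Suppose
an operator lives near three sparse syndromes but its defects lie in only two of them. Each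
connected piece of its support is small, and its defects form at most two clusters of diameter `4
ξ_q`. If the clusters are close, TQO2 recreates them together. If they are far apart, the no-strings
rule makes each neutral and TQO2 recreates them separately. By TQO1 the recreated operator agrees
with the piece up to a stabilizer (`Topological.localizedOn_near_syndrome`). The third syndrome is
thereby forgotten, and the localization radius does not grow along the path.

After `n` levels the product of the path is, up to stabilizers, supported within `(1200 * α) ^ n ≤
L_tqo` of its final defects. If none remain it is a stabilizer, so it cannot implement a logical
operator. If a final cluster is isolated by `5 * (1200 * α) ^ n`, restricting the operator to its
neighborhood creates that cluster alone, so it is neutral. A barrier violation thus forces `n` to be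
at least logarithmic in the available scale. -/

noncomputable section
namespace NoStrings

/-! ### Geometry of the periodic lattice -/

section Lattice

variable {D L : ℕ}

theorem torusDist_le_iff {u v : Lattice D L} {r : ℕ} :
    torusDist u v ≤ r ↔ ∀ i, (u i - v i).valMinAbs.natAbs ≤ r := by
  simp [torusDist, Finset.sup_le_iff]

theorem torusDist_self (u : Lattice D L) : torusDist u u = 0 := by
  rw [← Nat.le_zero, torusDist_le_iff]
  simp

theorem torusDist_comm (u v : Lattice D L) : torusDist u v = torusDist v u := by
  unfold torusDist
  congr 1
  ext i
  rw [← neg_sub, ZMod.natAbs_valMinAbs_neg]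

theorem torusDist_triangle (u v w : Lattice D L) :
    torusDist u w ≤ torusDist u v + torusDist v w := by
  rw [torusDist_le_iff]
  intro i
  have h1 := torusDist_le_iff.1 (le_refl (torusDist u v)) i
  have h2 := torusDist_le_iff.1 (le_refl (torusDist v w)) i
  have h3 := ZMod.natAbs_valMinAbs_add_le (u i - v i) (v i - w i)
  rw [sub_add_sub_cancel] at h3
  have h4 := Int.natAbs_add_le (u i - v i).valMinAbs (v i - w i).valMinAbs
  omega

/-- The ball of radius `r` centred at `x`. -/
def ball (x : Lattice D L) (r : ℕ) : Set (Lattice D L) := {u | torusDist u x ≤ r}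

theorem mem_ball {x u : Lattice D L} {r : ℕ} : u ∈ ball x r ↔ torusDist u x ≤ r := Iff.rfl

/-- `valMinAbs` is the representative of least absolute value, so any other representative bounds
it. -/
theorem natAbs_valMinAbs_intCast_le [NeZero L] (z : ℤ) :
    (z : ZMod L).valMinAbs.natAbs ≤ z.natAbs :=
  ZMod.natAbs_min_of_le_div_two L _ _ (by simp) (ZMod.natAbs_valMinAbs_le _)

theorem torusDist_le_of_mem_cube [NeZero L] {c u v : Lattice D L} {w : ℕ}
    (hu : u ∈ cube c (w : ℝ)) (hv : v ∈ cube c (w : ℝ)) : torusDist u v ≤ w := by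
  rw [torusDist_le_iff]
  intro i
  have h1 : (u i - c i).val ≤ w := by exact_mod_cast hu i
  have h2 : (v i - c i).val ≤ w := by exact_mod_cast hv i
  have h3 : u i - v i = (((u i - c i).val - (v i - c i).val : ℤ) : ZMod L) := by
    push_cast
    simp
  rw [h3]
  refine (natAbs_valMinAbs_intCast_le _).trans ?_
  omega

/-- A neighborhood of a cube is contained in a cube. -/
theorem mem_cube_of_torusDist_le [NeZero L] {x u v : Lattice D L} {s : ℝ} {k : ℕ}
    (hv : v ∈ cube x s) (huv : torusDist u v ≤ k) :
    u ∈ cube (fun i => x i - (k : ZMod L)) (s + 2 * k) := by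
  intro i
  have h1 := torusDist_le_iff.1 huv i
  -- The signed displacement lies in `[-k, k]`. Shifting the corner by `k` makes it a natural number
  -- at most `2 * k`, and `val` is subadditive.
  have h3 : u i - (x i - k) = (v i - x i) +
      ((((u i - v i).valMinAbs + k).toNat : ℕ) : ZMod L) := by
    have : ((((u i - v i).valMinAbs + k).toNat : ℤ) : ZMod L)
        = (((u i - v i).valMinAbs + k : ℤ) : ZMod L) := by
      rw [Int.toNat_of_nonneg (by omega)]
    rw [Int.cast_natCast] at this
    rw [this]
    push_cast [ZMod.coe_valMinAbs]
    ring
  rw [h3]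
  have h4 := ZMod.val_add_le (v i - x i) ((((u i - v i).valMinAbs + k).toNat : ℕ) : ZMod L)
  have h5 : ((((u i - v i).valMinAbs + k).toNat : ℕ) : ZMod L).val ≤ 2 * k := by
    rw [ZMod.val_natCast]
    refine (Nat.mod_le _ _).trans ?_
    omega
  have h6 := hv i
  have h7 : (((v i - x i) + ((((u i - v i).valMinAbs + k).toNat : ℕ) : ZMod L)).val : ℝ)
      ≤ ((v i - x i).val : ℝ) + (2 * k : ℕ) := by exact_mod_cast h4.trans (by omega)
  push_cast at h7
  linarith

theorem self_mem_cube [NeZero L] (x : Lattice D L) {s : ℝ} (hs : 0 ≤ s) : x ∈ cube x s := by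
  intro i
  simpa using hs

theorem ball_subset_cube [NeZero L] (x : Lattice D L) (r : ℕ) :
    ball x r ⊆ cube (fun i => x i - (r : ZMod L)) ((2 * r : ℕ) : ℝ) := by
  intro u hu
  have := mem_cube_of_torusDist_le (self_mem_cube x le_rfl) hu
  simpa using this

theorem cube_mono {x : Lattice D L} {s t : ℝ} (h : s ≤ t) : cube x s ⊆ cube x t :=
  fun _ hu i => (hu i).trans h

end Lattice

/-! ### Commutation of Pauli operators and the symplectic form -/

section PauliAlgebra

/-- The character of `ZMod 2`. -/
def parity (x : ZMod 2) : ℂ := if x = 0 then 1 else -1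

theorem parity_add (x y : ZMod 2) : parity (x + y) = parity x * parity y := by
  have key : ∀ a : ZMod 2, a = 0 ∨ a = 1 := by decide
  have h11 : (1 : ZMod 2) + 1 = 0 := by decide
  rcases key x with rfl | rfl <;> rcases key y with rfl | rfl <;> simp [parity, h11]

theorem parity_sum {ι : Type*} (s : Finset ι) (f : ι → ZMod 2) :
    parity (∑ i ∈ s, f i) = ∏ i ∈ s, parity (f i) := by
  classical
  induction s using Finset.induction_on with
  | empty => simp [parity]
  | insert a s ha ih => rw [Finset.sum_insert ha, Finset.prod_insert ha, parity_add, ih]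

theorem pauliMatrix_mul_comm (p p' : ZMod 2 × ZMod 2) :
    pauliMatrix p * pauliMatrix p'
      = parity (p.1 * p'.2 + p.2 * p'.1) • (pauliMatrix p' * pauliMatrix p) := by
  have h11 : (1 : ZMod 2) + 1 = 0 := by decide
  have key : ∀ a : ZMod 2, a = 0 ∨ a = 1 := by decide
  obtain ⟨a, b⟩ := p
  obtain ⟨a', b'⟩ := p'
  rcases key a with rfl | rfl <;> rcases key b with rfl | rfl <;>
    rcases key a' with rfl | rfl <;> rcases key b' with rfl | rfl <;>
    ext i j <;> fin_cases i <;> fin_cases j <;>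
        simp [pauliMatrix, parity, Matrix.mul_apply, Fin.sum_univ_two, h11]

variable {Q : Type} [Fintype Q]

/-- The symplectic form: it vanishes iff the Pauli operators commute. -/
def symplectic (P P' : Pauli Q) : ZMod 2 := ∑ q, ((P q).1 * (P' q).2 + (P q).2 * (P' q).1)

variable [DecidableEq Q]

theorem toMatrix_mul_apply (P P' : Pauli Q) (i j : Q → Fin 2) :
    (P.toMatrix * P'.toMatrix) i j
      = ∏ q, (pauliMatrix (P q) * pauliMatrix (P' q)) (i q) (j q) := by
  simp only [Matrix.mul_apply, Pauli.toMatrix, ← Finset.prod_mul_distrib]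
  rw [Finset.prod_univ_sum]
  simp [Fintype.piFinset_univ]

theorem toMatrix_mul_comm (P P' : Pauli Q) :
    P.toMatrix * P'.toMatrix = parity (symplectic P P') • (P'.toMatrix * P.toMatrix) := by
  ext i j
  rw [Matrix.smul_apply, toMatrix_mul_apply, toMatrix_mul_apply, symplectic, parity_sum,
    smul_eq_mul, ← Finset.prod_mul_distrib]
  refine Finset.prod_congr rfl fun q _ => ?_
  rw [pauliMatrix_mul_comm]
  simp

theorem toMatrix_zero : Pauli.toMatrix (0 : Pauli Q) = 1 := by
  ext i j
  by_cases h : i = j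
  · subst h
    simp [Pauli.toMatrix, pauliMatrix]
  · obtain ⟨q, hq⟩ := Function.ne_iff.1 h
    rw [Matrix.one_apply_ne h]
    exact Finset.prod_eq_zero (Finset.mem_univ q) (by simp [pauliMatrix, hq])

theorem pauli_add_self {Q : Type} (P : Pauli Q) : P + P = 0 := by
  have key : ∀ a : ZMod 2 × ZMod 2, a + a = 0 := by decide
  funext q
  exact key _

theorem toMatrix_ne_zero (P : Pauli Q) : P.toMatrix ≠ 0 := by
  intro h
  obtain ⟨c, hc, h2⟩ := exists_phase_toMatrix_mul P P
  rw [pauli_add_self, toMatrix_zero, h, zero_mul] at h2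
  have h3 := congrFun (congrFun h2 0) 0
  simp only [Matrix.zero_apply, Matrix.smul_apply, Matrix.one_apply_eq, smul_eq_mul, mul_one] at h3
  rw [← h3] at hc
  simp at hc

theorem toMatrix_mul_ne_zero (P P' : Pauli Q) : P.toMatrix * P'.toMatrix ≠ 0 := by
  obtain ⟨c, hc, h⟩ := exists_phase_toMatrix_mul P P'
  rw [h]
  refine smul_ne_zero ?_ (toMatrix_ne_zero _)
  rintro rfl
  simp at hc

theorem eq_zero_of_eq_neg {ι : Type*} {A : Matrix ι ι ℂ} (h : A = -A) : A = 0 := by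
  ext i j
  exact self_eq_neg.1 (congrFun (congrFun h i) j)

end PauliAlgebra

/-! ### Syndromes and stabilizers as linear data -/

namespace StabilizerHamiltonian

variable {D L : ℕ} [NeZero L] (H : StabilizerHamiltonian D L)

/-- The indicator of the syndrome, as an additive map. -/
def flip : H.Op →+ (Fin H.M → ZMod 2) where
  toFun E a := symplectic (H.gen a) E
  map_zero' := by
    funext a
    simp [symplectic]
  map_add' E F := by
    funext a
    simp only [symplectic, Pi.add_apply, Prod.fst_add, Prod.snd_add, ← Finset.sum_add_distrib]
    refine Finset.sum_congr rfl fun q _ => ?_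
    ring

theorem term_mul (a : Fin H.M) (E : H.Op) :
    H.term a * E.toMatrix = parity (H.flip E a) • (E.toMatrix * H.term a) := by
  unfold term
  rw [Matrix.smul_mul, toMatrix_mul_comm, Matrix.mul_smul, smul_comm]
  rfl

theorem mul_term_ne_zero (a : Fin H.M) (E : H.Op) : E.toMatrix * H.term a ≠ 0 := by
  unfold term
  rw [Matrix.mul_smul]
  refine smul_ne_zero ?_ (toMatrix_mul_ne_zero _ _)
  rcases Int.units_eq_one_or (H.sign a) with h | h <;> simp [h]

/-- Exchanging two Pauli operators costs a sign, and their product is nonzero, so they anticommute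
exactly when the sign is `-1`. This makes syndromes additive through `flip`. -/
theorem mem_syndrome {a : Fin H.M} {E : H.Op} : a ∈ H.syndrome E ↔ H.flip E a ≠ 0 := by
  have h2 := H.mul_term_ne_zero a E
  simp only [syndrome, Finset.mem_filter, Finset.mem_univ, true_and]
  rw [term_mul]
  by_cases h : H.flip E a = 0
  · simp only [h, parity, if_true, one_smul, ne_eq, not_true, iff_false]
    intro h3
    exact h2 (eq_zero_of_eq_neg h3)
  · simp [h, parity]

theorem syndrome_eq_of_flip_eq {E F : H.Op} (h : H.flip E = H.flip F) :
    H.syndrome E = H.syndrome F := by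
  ext a
  rw [mem_syndrome, mem_syndrome, h]

theorem syndrome_eq_empty_iff {E : H.Op} : H.syndrome E = ∅ ↔ H.flip E = 0 := by
  constructor
  · intro h
    funext a
    by_contra h2
    have := H.mem_syndrome.2 h2
    simp [h] at this
  · intro h
    ext a
    simp [mem_syndrome, h]

theorem flip_eq_of_syndrome_eq {E F : H.Op} (h : H.syndrome E = H.syndrome F) :
    H.flip E = H.flip F := by
  have key : ∀ x y : ZMod 2, (x ≠ 0 ↔ y ≠ 0) → x = y := by decide
  funext a
  refine key _ _ ?_
  rw [← mem_syndrome, ← mem_syndrome, h]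

theorem syndrome_zero : H.syndrome 0 = ∅ := H.syndrome_eq_empty_iff.2 (map_zero _)

theorem syndrome_add_subset (E F : H.Op) :
    H.syndrome (E + F) ⊆ H.syndrome E ∪ H.syndrome F := by
  intro a ha
  rw [Finset.mem_union, mem_syndrome, mem_syndrome]
  rw [mem_syndrome, map_add, Pi.add_apply] at ha
  by_contra! h
  simp [h.1, h.2] at ha

theorem op_neg (E : H.Op) : -E = E := neg_eq_of_add_eq_zero_left (pauli_add_self E)

/-- The Pauli operators that are stabilizers up to phase. -/
def stabilizers : AddSubgroup H.Op where
  carrier := {E | H.IsStabilizer E}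
  zero_mem' := ⟨1, by simp, by
    rw [toMatrix_zero, one_smul]
    exact Submonoid.one_mem _⟩
  add_mem' := by
    rintro E F ⟨c, hc, hE⟩ ⟨d, hd, hF⟩
    obtain ⟨e, he, h⟩ := exists_phase_toMatrix_mul E F
    have he0 : e ≠ 0 := by
      rintro rfl
      simp at he
    refine ⟨c * d * e, by simp [hc, hd, he], ?_⟩
    have := Submonoid.mul_mem _ hE hF
    rw [Matrix.smul_mul, Matrix.mul_smul, h, smul_smul, smul_smul] at this
    exact this
  neg_mem' := by
    intro E hE
    rw [H.op_neg E]
    exact hE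

theorem mem_stabilizers {E : H.Op} : E ∈ H.stabilizers ↔ H.IsStabilizer E := Iff.rfl

theorem flip_eq_zero_of_mem_stabilizers {E : H.Op} (hE : E ∈ H.stabilizers) : H.flip E = 0 := by
  obtain ⟨c, hc, hE⟩ := hE
  have hc0 : c ≠ 0 := by
    rintro rfl
    simp at hc
  rw [← H.syndrome_eq_empty_iff, Finset.eq_empty_iff_forall_notMem]
  intro a ha
  have hcomm : Commute (H.term a) (c • E.toMatrix) := by
    have hle : Submonoid.closure (Set.range H.term) ≤ Submonoid.centralizer {H.term a} := by
      rw [Submonoid.closure_le]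
      rintro _ ⟨b, rfl⟩
      rw [SetLike.mem_coe, Submonoid.mem_centralizer_iff]
      rintro _ rfl
      exact H.commute a b
    exact Submonoid.mem_centralizer_iff.1 (hle hE) _ rfl
  have h1 : H.term a * E.toMatrix = E.toMatrix * H.term a := by
    have := hcomm.eq
    rw [Matrix.mul_smul, Matrix.smul_mul] at this
    exact smul_right_injective _ hc0 this
  simp only [syndrome, Finset.mem_filter, Finset.mem_univ, true_and] at ha
  rw [h1] at ha
  exact H.mul_term_ne_zero a E (eq_zero_of_eq_neg ha)

theorem flip_eq_of_sub_mem {E F : H.Op} (h : E - F ∈ H.stabilizers) : H.flip E = H.flip F := by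
  have := H.flip_eq_zero_of_mem_stabilizers h
  rwa [map_sub, sub_eq_zero] at this

end StabilizerHamiltonian

namespace StabilizerHamiltonian

variable {D L : ℕ} [NeZero L] (H : StabilizerHamiltonian D L)

/-! ### Cutting an operator into separated pieces -/

section Restriction

open Classical in
/-- The restriction of a Pauli operator to a set of sites. -/
def restrict (A : Set (Lattice D L)) (E : H.Op) : H.Op := fun q => if q.1 ∈ A then E q else 0

theorem support_restrict (A : Set (Lattice D L)) (E : H.Op) :
    support (H.restrict A E) = support E ∩ A := by
  ext u
  by_cases h : u ∈ A <;> simp [support, restrict, h]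

theorem restrict_add_restrict_compl (A : Set (Lattice D L)) (E : H.Op) :
    H.restrict A E + H.restrict Aᶜ E = E := by
  funext q
  by_cases h : q.1 ∈ A <;> simp [restrict, h]

theorem support_add_subset (E F : H.Op) : support (E + F) ⊆ support E ∪ support F := by
  rintro u ⟨k, hk⟩
  by_contra h
  simp only [Set.mem_union, support, Set.mem_ofPred_eq, not_or, not_exists, not_not] at h
  exact hk (by simp [h.1 k, h.2 k])

theorem support_sub_subset (E F : H.Op) : support (E - F) ⊆ support E ∪ support F := by
  rw [sub_eq_add_neg, H.op_neg]
  exact H.support_add_subset E F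

theorem support_zero : support (0 : H.Op) = ∅ := by
  ext u
  simp [support]

theorem eq_zero_of_support_eq_empty {E : H.Op} (h : support E = ∅) : E = 0 := by
  funext q
  by_contra hq
  have : q.1 ∈ support E := ⟨q.2, hq⟩
  simp [h] at this

theorem torusDist_loc_le {a : Fin H.M} {u : Lattice D L} (hu : u ∈ cube (H.loc a) 1) :
    torusDist u (H.loc a) ≤ 1 := by
  refine torusDist_le_of_mem_cube (c := H.loc a) (by simpa using hu) ?_
  exact self_mem_cube _ (by simp)

theorem flip_congr {E F : H.Op} {a : Fin H.M}
    (h : ∀ q : Qubit H.numQubits, q.1 ∈ cube (H.loc a) 1 → E q = F q) :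
    H.flip E a = H.flip F a := by
  change symplectic _ _ = symplectic _ _
  refine Finset.sum_congr rfl fun q _ => ?_
  by_cases hq : q.1 ∈ cube (H.loc a) 1
  · rw [h q hq]
  · have h0 : H.gen a q = 0 := by
      by_contra h1
      exact hq (H.support_gen a ⟨q.2, h1⟩)
    simp [h0]

theorem exists_support_of_mem_syndrome {E : H.Op} {a : Fin H.M} (ha : a ∈ H.syndrome E) :
    ∃ u ∈ support E, u ∈ cube (H.loc a) 1 := by
  by_contra! h
  rw [mem_syndrome] at ha
  refine ha ?_
  rw [H.flip_congr (F := 0), map_zero, Pi.zero_apply]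
  intro q hq
  by_contra h1
  exact h q.1 ⟨q.2, h1⟩ hq

/-- An elementary cube has diameter at most `1`, so a generator that meets the part of the support
inside `A` cannot see the part outside. -/
theorem flip_restrict_eq {E : H.Op} {A : Set (Lattice D L)}
    (hA : ∀ u ∈ support E, u ∈ A → ∀ v ∈ support E, v ∉ A → 1 < torusDist u v)
    {a : Fin H.M} {u : Lattice D L} (hu : u ∈ support E) (huA : u ∈ A)
    (hua : u ∈ cube (H.loc a) 1) : H.flip (H.restrict A E) a = H.flip E a := by
  refine H.flip_congr fun q hq => ?_
  by_cases hqA : q.1 ∈ A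
  · simp [restrict, hqA]
  · by_cases h0 : E q = 0
    · simp [restrict, h0]
    · have h1 := hA u hu huA q.1 ⟨q.2, h0⟩ hqA
      have h2 : torusDist u q.1 ≤ 1 :=
        torusDist_le_of_mem_cube (c := H.loc a) (by simpa using hua) (by simpa using hq)
      omega

theorem syndrome_restrict_subset {E : H.Op} {A : Set (Lattice D L)}
    (hA : ∀ u ∈ support E, u ∈ A → ∀ v ∈ support E, v ∉ A → 1 < torusDist u v) :
    H.syndrome (H.restrict A E) ⊆ H.syndrome E := by
  intro a ha
  obtain ⟨u, hu, hua⟩ := H.exists_support_of_mem_syndrome ha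
  rw [support_restrict] at hu
  rw [mem_syndrome] at ha ⊢
  rwa [H.flip_restrict_eq hA hu.1 hu.2 hua] at ha

end Restriction

/-! ### Localization up to stabilizers and sparse clusters -/

section Localization

/-- The sites within distance `r` of the corners of the cubes occupied by the defects in `S`. -/
def near (r : ℕ) (S : Finset (Fin H.M)) : Set (Lattice D L) :=
  {u | ∃ a ∈ S, torusDist u (H.loc a) ≤ r}

theorem near_mono {r s : ℕ} {S T : Finset (Fin H.M)} (hrs : r ≤ s) (hST : S ⊆ T) :
    H.near r S ⊆ H.near s T := by
  rintro u ⟨a, ha, h⟩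
  exact ⟨a, hST ha, h.trans hrs⟩

/-- Up to a stabilizer, `E` is supported on `Z`. -/
def LocalizedOn (Z : Set (Lattice D L)) (E : H.Op) : Prop :=
  ∃ E' : H.Op, E - E' ∈ H.stabilizers ∧ support E' ⊆ Z

variable {H}

theorem LocalizedOn.mono {Z Z' : Set (Lattice D L)} {E : H.Op} (h : H.LocalizedOn Z E)
    (hZ : Z ⊆ Z') : H.LocalizedOn Z' E := by
  obtain ⟨E', h1, h2⟩ := h
  exact ⟨E', h1, h2.trans hZ⟩

theorem LocalizedOn.add {Z : Set (Lattice D L)} {E F : H.Op} (hE : H.LocalizedOn Z E)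
    (hF : H.LocalizedOn Z F) : H.LocalizedOn Z (E + F) := by
  obtain ⟨E', h1, h2⟩ := hE
  obtain ⟨F', h3, h4⟩ := hF
  refine ⟨E' + F', ?_, (H.support_add_subset _ _).trans (Set.union_subset h2 h4)⟩
  rw [add_sub_add_comm]
  exact add_mem h1 h3

theorem localizedOn_of_mem_stabilizers {Z : Set (Lattice D L)} {E : H.Op}
    (hE : E ∈ H.stabilizers) : H.LocalizedOn Z E :=
  ⟨0, by simpa using hE, by simp [H.support_zero]⟩

theorem LocalizedOn.of_sub_mem {Z : Set (Lattice D L)} {E F : H.Op} (h : E - F ∈ H.stabilizers)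
    (hF : H.LocalizedOn Z F) : H.LocalizedOn Z E := by
  have := (localizedOn_of_mem_stabilizers (Z := Z) h).add hF
  rwa [sub_add_cancel] at this

variable (H)

/-- A set of sites that does not split into two parts at distance more than `1`. -/
def Indecomposable (K : Set (Lattice D L)) : Prop :=
  ∀ A : Set (Lattice D L), (∀ u ∈ K, u ∈ A → ∀ v ∈ K, v ∉ A → 1 < torusDist u v) →
    K ⊆ A ∨ Disjoint K A

/-- It suffices to localize the operators with indecomposable support. -/
theorem localizedOn_of_indecomposable {W Z : Set (Lattice D L)} {X : Finset (Fin H.M)}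
    (h : ∀ E : H.Op, support E ⊆ W → H.syndrome E ⊆ X → Indecomposable (support E) →
      H.LocalizedOn Z E) (E : H.Op) (hW : support E ⊆ W) (hX : H.syndrome E ⊆ X) :
    H.LocalizedOn Z E := by
  -- A decomposable support splits into two strictly smaller pieces, and neither piece creates a
  -- defect outside the syndrome of `E`.
  induction hn : (support E).ncard using Nat.strong_induction_on generalizing E with
  | _ n ih =>
    by_cases hE : Indecomposable (support E)
    · exact h E hW hX hE
    · unfold Indecomposable at hE
      push Not at hE
      obtain ⟨A, hA, h1, h2⟩ := hE
      have hA' : ∀ u ∈ support E, u ∈ Aᶜ → ∀ v ∈ support E, v ∉ Aᶜ → 1 < torusDist u v := by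
        intro u hu huA v hv hvA
        rw [torusDist_comm]
        exact hA v hv (not_not.1 hvA) u hu huA
      rw [← H.restrict_add_restrict_compl A E]
      refine LocalizedOn.add (ih _ ?_ _ ?_ ?_ rfl) (ih _ ?_ _ ?_ ?_ rfl)
      · rw [← hn, support_restrict]
        refine Set.ncard_lt_ncard ?_ (Set.toFinite _)
        refine ⟨Set.inter_subset_left, fun h3 => h1 fun u hu => (h3 hu).2⟩
      · rw [support_restrict]
        exact Set.inter_subset_left.trans hW
      · exact (H.syndrome_restrict_subset hA).trans hX
      · rw [← hn, support_restrict]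
        refine Set.ncard_lt_ncard ?_ (Set.toFinite _)
        refine ⟨Set.inter_subset_left, fun h3 => h2 ?_⟩
        rw [Set.disjoint_left]
        exact fun u hu => (h3 hu).2
      · rw [support_restrict]
        exact Set.inter_subset_left.trans hW
      · exact (H.syndrome_restrict_subset hA').trans hX

/-- No distance between two defects in `S` lies between `4 * ξ` and `Ξ`. -/
def Sparse (ξ Ξ : ℕ) (S : Finset (Fin H.M)) : Prop :=
  ∀ a ∈ S, ∀ b ∈ S, torusDist (H.loc a) (H.loc b) ≤ 4 * ξ ∨ Ξ < torusDist (H.loc a) (H.loc b)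

/-- An indecomposable set that is locally near three sparse clusters is small. -/
theorem Indecomposable.subset_ball {K : Set (Lattice D L)} (hK : Indecomposable K)
    {u₀ : Lattice D L} (hu₀ : u₀ ∈ K) {ξ Ξ r : ℕ} {Y : Fin 3 → Finset (Fin H.M)}
    (hY : ∀ i, H.Sparse ξ Ξ (Y i))
    (hr : ∀ u ∈ K, u ∈ ball u₀ (3 * (4 * ξ + 2 * r + 1)) → ∃ i, u ∈ H.near r (Y i))
    (hΞ : 2 * (3 * (4 * ξ + 2 * r + 1)) + 2 * r ≤ Ξ) :
    K ⊆ ball u₀ (3 * (4 * ξ + 2 * r + 1)) := by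
  set δ := 4 * ξ + 2 * r + 1 with hδ
  -- Look at the spheres of radius `0, δ, 2δ, 3δ` about `u₀`. A sphere missed by `K` separates its
  -- inside from its outside by distance at least `2`.
  by_cases h : ∃ j : Fin 4, ∀ u ∈ K, torusDist u u₀ ≠ j * δ
  · obtain ⟨j, hj⟩ := h
    have hj3 : (j : ℕ) * δ ≤ 3 * δ := Nat.mul_le_mul_right _ (by omega)
    have hsep : ∀ u ∈ K, u ∈ {u | torusDist u u₀ < j * δ} → ∀ v ∈ K,
        v ∉ {u | torusDist u u₀ < j * δ} → 1 < torusDist u v := by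
      intro u hu huA v hv hvA
      rw [Set.mem_ofPred_eq] at huA hvA
      have h2 := hj v hv
      have h3 := torusDist_triangle v u u₀
      rw [torusDist_comm v u] at h3
      omega
    rcases hK _ hsep with h1 | h1
    · intro u hu
      have := h1 hu
      rw [mem_ball]
      rw [Set.mem_ofPred_eq] at this
      omega
    · exfalso
      refine Set.disjoint_left.1 h1 hu₀ ?_
      have := hj u₀ hu₀
      rw [Set.mem_ofPred_eq]
      rw [torusDist_self] at this ⊢
      exact Nat.pos_of_ne_zero this.symm
  · exfalso
    push Not at h
    choose u hu hd using h
    have hball : ∀ j, u j ∈ ball u₀ (3 * δ) := by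
      intro j
      rw [mem_ball, hd]
      exact Nat.mul_le_mul_right _ (by omega)
    choose i hi using fun j => hr (u j) (hu j) (hball j)
    -- Four points, three clusters: two points are near the same one. Their defects are then at
    -- distance at least `δ - 2 * r > 4 * ξ` and at most `6 * δ + 2 * r ≤ Ξ`, which sparsity
    -- forbids.
    obtain ⟨j, k, hjk, hijk⟩ := Fintype.exists_ne_map_eq_of_card_lt i (by simp)
    wlog hlt : j < k generalizing j k
    · exact this k j hjk.symm hijk.symm (lt_of_le_of_ne (not_lt.1 hlt) hjk.symm)
    obtain ⟨a, ha, hja⟩ := hi j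
    obtain ⟨b, hb, hkb⟩ := hi k
    rw [← hijk] at hb
    have h1 := hball j
    have h2 := hball k
    rw [mem_ball] at h1 h2
    have h3 := torusDist_triangle (H.loc a) (u j) (H.loc b)
    have h4 := torusDist_triangle (u j) (u k) (H.loc b)
    have h5 := torusDist_triangle (u j) u₀ (u k)
    have h6 := torusDist_triangle (u k) (u j) u₀
    have h7 := torusDist_triangle (u k) (H.loc b) (u j)
    have h8 := torusDist_triangle (H.loc b) (H.loc a) (u j)
    rw [torusDist_comm (H.loc a) (u j)] at h3 h8
    rw [torusDist_comm u₀ (u k)] at h5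
    rw [torusDist_comm (H.loc b) (H.loc a)] at h8
    have h9 : (j : ℕ) * δ + δ ≤ k * δ := by
      have : ((j : ℕ) + 1) * δ ≤ k * δ := Nat.mul_le_mul_right _ hlt
      rwa [add_mul, one_mul] at this
    have h10 := hd j
    have h11 := hd k
    rcases hY (i j) a ha b hb with h12 | h12 <;> omega

end Localization

end StabilizerHamiltonian

/-! ### Consequences of topological order and the no-strings rule -/

namespace StabilizerHamiltonian

variable {D L : ℕ} [NeZero L] (H : StabilizerHamiltonian D L)

/-- The topological order conditions and the no-strings rule with an integral constant. -/
structure Topological (ℓ : ℝ) (α : ℕ) : Prop where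
  one_le : 1 ≤ α
  tqo1 : H.TQO1 ℓ
  tqo2 : H.TQO2 ℓ
  noStrings : H.NoStringsRule ℓ α

variable {H}

theorem fits_of_subset_ball {E : H.Op} {x : Lattice D L} {ρ : ℕ} {ℓ : ℝ}
    (hE : support E ⊆ ball x ρ) (hρ : ((2 * ρ : ℕ) : ℝ) ≤ ℓ) : H.Fits ℓ E :=
  ⟨_, hE.trans ((ball_subset_cube x ρ).trans (cube_mono hρ))⟩

theorem cube_loc_subset {a : Fin H.M} {x : Lattice D L} {d : ℕ} (h : torusDist (H.loc a) x ≤ d) :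
    cube (H.loc a) 1 ⊆ cube (fun i => x i - ((d + 1 : ℕ) : ZMod L)) ((2 * (d + 1) : ℕ) : ℝ) := by
  intro u hu
  refine ball_subset_cube x (d + 1) ?_
  have h1 := H.torusDist_loc_le hu
  have h2 := torusDist_triangle u (H.loc a) x
  rw [mem_ball]
  omega

theorem loc_mem_cube (a : Fin H.M) : H.loc a ∈ cube (H.loc a) 1 :=
  self_mem_cube _ zero_le_one

theorem mem_defectsIn {E : H.Op} {A : Set (Lattice D L)} {a : Fin H.M} :
    a ∈ H.defectsIn E A ↔ a ∈ H.syndrome E ∧ cube (H.loc a) 1 ⊆ A := by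
  simp [defectsIn]

variable {ℓ : ℝ} {α : ℕ}

theorem Topological.mem_stabilizers (hH : H.Topological ℓ α) {E : H.Op} {x : Lattice D L} {ρ : ℕ}
    (hE : support E ⊆ ball x ρ) (hρ : ((2 * ρ : ℕ) : ℝ) ≤ ℓ) (h : H.syndrome E = ∅) :
    E ∈ H.stabilizers :=
  hH.tqo1 E h (fits_of_subset_ball hE hρ)

/-- TQO2 in terms of balls. -/
theorem Topological.exists_support_subset_ball (hH : H.Topological ℓ α) {C : Finset (Fin H.M)}
    (hC : H.Neutral ℓ C) {a : Fin H.M} (ha : a ∈ C) {d : ℕ}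
    (hd : ∀ b ∈ C, torusDist (H.loc b) (H.loc a) ≤ d) :
    ∃ E : H.Op, support E ⊆ ball (H.loc a) (2 * d + 3) ∧ H.syndrome E = C := by
  obtain ⟨c, r, ⟨h1, h2⟩, E, hE, hEC⟩ := hH.tqo2 C hC
  refine ⟨E, fun u hu => ?_, hEC⟩
  obtain ⟨v, hv, huv⟩ := hE hu
  -- The ball of radius `d + 1` around `H.loc a` contains all the elementary cubes of `C`. The
  -- `1`-neighborhood then adds one to this size, giving `2 * d + 3`.
  have hr : r ≤ 2 * (d + 1) := by
    refine h2 (fun i => H.loc a i - ((d + 1 : ℕ) : ZMod L)) _ (Set.iUnion₂_subset fun b hb => ?_)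
    exact cube_loc_subset (hd b hb)
  have h3 : torusDist v (H.loc a) ≤ r :=
    torusDist_le_of_mem_cube hv (h1 (Set.mem_biUnion ha (loc_mem_cube a)))
  have h4 := torusDist_triangle u v (H.loc a)
  rw [mem_ball]
  omega

/-- A local operator whose defects form two small clusters can be moved close to its defects. -/
theorem Topological.localizedOn_near_syndrome (hH : H.Topological ℓ α) {E : H.Op}
    {x : Lattice D L} {ρ ξ : ℕ} (hξ : 1 ≤ ξ) (hE : support E ⊆ ball x ρ)
    {C₁ C₂ : Finset (Fin H.M)} (hC : H.syndrome E = C₁ ∪ C₂)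
    (h₁ : ∀ a ∈ C₁, ∀ b ∈ C₁, torusDist (H.loc a) (H.loc b) ≤ 4 * ξ)
    (h₂ : ∀ a ∈ C₂, ∀ b ∈ C₂, torusDist (H.loc a) (H.loc b) ≤ 4 * ξ)
    (hfit : ((2 * (ρ + 1 + 71 * (α * ξ)) : ℕ) : ℝ) ≤ ℓ) :
    H.LocalizedOn (H.near (71 * (α * ξ)) (H.syndrome E)) E := by
  have hα := hH.one_le
  set m := α * ξ with hm
  have hξm : ξ ≤ m := Nat.le_mul_of_pos_left _ hα
  have hαm : α ≤ m := Nat.le_mul_of_pos_right _ hξ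
  have hx : ∀ a ∈ H.syndrome E, torusDist (H.loc a) x ≤ ρ + 1 := by
    intro a ha
    obtain ⟨u, hu, hua⟩ := H.exists_support_of_mem_syndrome ha
    have h3 := hE hu
    have h4 := H.torusDist_loc_le hua
    have h5 := torusDist_triangle (H.loc a) u x
    rw [mem_ball] at h3
    rw [torusDist_comm] at h4
    omega
  have hfits : H.Fits ℓ E := by
    refine fits_of_subset_ball hE (le_trans ?_ hfit)
    exact_mod_cast (by omega : 2 * ρ ≤ 2 * (ρ + 1 + 71 * m))
  have hneutral : H.Neutral ℓ (H.syndrome E) := ⟨E, hfits, rfl⟩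
  -- an operator near the defects with the same syndrome is equivalent to `E`
  have hsub : ∀ F : H.Op, support F ⊆ ball x (ρ + 1 + 71 * m) → H.syndrome F = H.syndrome E →
      E - F ∈ H.stabilizers := by
    intro F hF hFE
    refine hH.mem_stabilizers (x := x) ?_ hfit ?_
    · refine (H.support_sub_subset E F).trans (Set.union_subset (hE.trans ?_) hF)
      intro u hu
      rw [mem_ball] at hu ⊢
      omega
    · rw [syndrome_eq_empty_iff, map_sub, H.flip_eq_of_syndrome_eq hFE, sub_self]
  have hball : ∀ a ∈ H.syndrome E, ball (H.loc a) (71 * m) ⊆ ball x (ρ + 1 + 71 * m) := by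
    intro a ha u hu
    have h3 := hx a ha
    have h4 := torusDist_triangle u (H.loc a) x
    rw [mem_ball] at hu ⊢
    omega
  have hone : ∀ a ∈ H.syndrome E, ∀ d, 2 * d + 3 ≤ 71 * m →
      (∀ b ∈ H.syndrome E, torusDist (H.loc b) (H.loc a) ≤ d) →
      H.LocalizedOn (H.near (71 * m) (H.syndrome E)) E := by
    intro a ha d hd hb
    obtain ⟨F, hF, hFE⟩ := hH.exists_support_subset_ball hneutral ha hb
    have hF' : support F ⊆ ball (H.loc a) (71 * m) := fun u hu => (hF hu).trans hd
    exact ⟨F, hsub F (hF'.trans (hball a ha)) hFE, fun u hu => ⟨a, ha, hF' hu⟩⟩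
  rcases C₁.eq_empty_or_nonempty with rfl | ⟨a₁, ha₁⟩
  · rw [Finset.empty_union] at hC
    rcases C₂.eq_empty_or_nonempty with rfl | ⟨a₂, ha₂⟩
    · refine localizedOn_of_mem_stabilizers ?_
      have := hsub 0 (by simp [H.support_zero]) (by rw [hC, H.syndrome_zero])
      simpa using this
    · rw [← hC] at h₂ ha₂
      exact hone a₂ ha₂ (4 * ξ) (by omega) fun b hb => h₂ b hb a₂ ha₂
  rcases C₂.eq_empty_or_nonempty with rfl | ⟨a₂, ha₂⟩
  · rw [Finset.union_empty] at hC
    rw [← hC] at h₁ ha₁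
    exact hone a₁ ha₁ (4 * ξ) (by omega) fun b hb => h₁ b hb a₁ ha₁
  have ha₁E : a₁ ∈ H.syndrome E := hC ▸ Finset.mem_union_left _ ha₁
  have ha₂E : a₂ ∈ H.syndrome E := hC ▸ Finset.mem_union_right _ ha₂
  set w := 2 * (4 * ξ + 1) with hw
  set c₁ : Lattice D L := fun i => H.loc a₁ i - ((4 * ξ + 1 : ℕ) : ZMod L) with hc₁
  set c₂ : Lattice D L := fun i => H.loc a₂ i - ((4 * ξ + 1 : ℕ) : ZMod L) with hc₂
  have hA₁ : ∀ b ∈ C₁, cube (H.loc b) 1 ⊆ cube c₁ (w : ℝ) :=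
    fun b hb => cube_loc_subset (h₁ b hb a₁ ha₁)
  have hA₂ : ∀ b ∈ C₂, cube (H.loc b) 1 ⊆ cube c₂ (w : ℝ) :=
    fun b hb => cube_loc_subset (h₂ b hb a₂ ha₂)
  have hm3 : α * w = 8 * m + 2 * α := by
    rw [hw, hm]
    ring
  -- Close anchors: all defects form one neutral cluster of radius `2 * w + α * w + 4 * ξ ≤ 34 * m`,
  -- and `2 * (34 * m) + 3 ≤ 71 * m` is the origin of the constant `71`.
  by_cases hdist : ∃ u ∈ cube c₁ (w : ℝ), ∃ v ∈ cube c₂ (w : ℝ), torusDist u v ≤ α * w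
  · obtain ⟨u, hu, v, hv, huv⟩ := hdist
    refine hone a₁ ha₁E (2 * w + α * w + 4 * ξ) (by omega) fun b hb => ?_
    rw [hC, Finset.mem_union] at hb
    rcases hb with hb | hb
    · have := h₁ b hb a₁ ha₁
      omega
    · have h3 : torusDist (H.loc b) v ≤ w :=
        torusDist_le_of_mem_cube (hA₂ b hb (loc_mem_cube b)) hv
      have h4 : torusDist u (H.loc a₁) ≤ w :=
        torusDist_le_of_mem_cube hu (hA₁ a₁ ha₁ (loc_mem_cube a₁))
      have h5 := torusDist_triangle (H.loc b) v (H.loc a₁)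
      have h6 := torusDist_triangle v u (H.loc a₁)
      rw [torusDist_comm v u] at h6
      omega
  -- Far anchors are disjoint, so each holds exactly its own cluster, and the no-strings rule makes
  -- both clusters neutral.
  · have hfar : ∀ b, ¬ (cube (H.loc b) 1 ⊆ cube c₁ (w : ℝ) ∧ cube (H.loc b) 1 ⊆ cube c₂ (w : ℝ)) := by
      rintro b ⟨h3, h4⟩
      exact hdist ⟨_, h3 (loc_mem_cube b), _, h4 (loc_mem_cube b), by simp [torusDist_self]⟩
    have hd₁ : H.defectsIn E (cube c₁ (w : ℝ)) = C₁ := by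
      ext b
      rw [mem_defectsIn, hC, Finset.mem_union]
      exact ⟨fun h => h.1.resolve_right fun h3 => hfar b ⟨h.2, hA₂ b h3⟩,
        fun h => ⟨Or.inl h, hA₁ b h⟩⟩
    have hd₂ : H.defectsIn E (cube c₂ (w : ℝ)) = C₂ := by
      ext b
      rw [mem_defectsIn, hC, Finset.mem_union]
      exact ⟨fun h => h.1.resolve_left fun h3 => hfar b ⟨hA₁ b h3, h.2⟩,
        fun h => ⟨Or.inr h, hA₂ b h⟩⟩
    have hstring : H.IsStringSegment ℓ w c₁ c₂ E := by
      refine ⟨hfits, fun b hb => ?_⟩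
      rw [hC, Finset.mem_union] at hb
      exact hb.imp (hA₁ b) (hA₂ b)
    have htriv : ¬ H.IsNontrivialSegment ℓ w c₁ c₂ E := by
      intro h
      obtain ⟨u, hu, v, hv, huv⟩ := hH.noStrings w c₁ c₂ E hstring h
      exact hdist ⟨u, hu, v, hv, by exact_mod_cast huv⟩
    rw [IsNontrivialSegment, not_or, not_not, not_not, hd₁, hd₂] at htriv
    obtain ⟨F₁, hF₁, hFC₁⟩ := hH.exists_support_subset_ball htriv.1 ha₁
      fun b hb => h₁ b hb a₁ ha₁
    obtain ⟨F₂, hF₂, hFC₂⟩ := hH.exists_support_subset_ball htriv.2 ha₂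
      fun b hb => h₂ b hb a₂ ha₂
    have hF₁' : support F₁ ⊆ ball (H.loc a₁) (71 * m) :=
      fun u hu => (mem_ball.1 (hF₁ hu)).trans (by omega)
    have hF₂' : support F₂ ⊆ ball (H.loc a₂) (71 * m) :=
      fun u hu => (mem_ball.1 (hF₂ hu)).trans (by omega)
    refine ⟨F₁ + F₂, hsub _ ?_ ?_, (H.support_add_subset _ _).trans (Set.union_subset ?_ ?_)⟩
    · exact (H.support_add_subset _ _).trans (Set.union_subset (hF₁'.trans (hball _ ha₁E))
        (hF₂'.trans (hball _ ha₂E)))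
    · have hdisj : ∀ b, ¬ (b ∈ C₁ ∧ b ∈ C₂) := fun b hb => hfar b ⟨hA₁ b hb.1, hA₂ b hb.2⟩
      ext b
      have h3 : H.flip F₁ b ≠ 0 ↔ b ∈ C₁ := by rw [← mem_syndrome, hFC₁]
      have h4 : H.flip F₂ b ≠ 0 ↔ b ∈ C₂ := by rw [← mem_syndrome, hFC₂]
      have h5 := hdisj b
      rw [mem_syndrome, map_add, Pi.add_apply, hC, Finset.mem_union]
      by_cases h6 : b ∈ C₁
      · have h7 : H.flip F₂ b = 0 := by
          by_contra h8
          exact h5 ⟨h6, h4.1 h8⟩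
        rw [h7, add_zero, h3]
        tauto
      · have h7 : H.flip F₁ b = 0 := by
          by_contra h8
          exact h6 (h3.1 h8)
        rw [h7, zero_add, h4]
        tauto
    · exact fun u hu => ⟨a₁, ha₁E, hF₁' hu⟩
    · exact fun u hu => ⟨a₂, ha₂E, hF₂' hu⟩

/-- Elimination of an intermediate sparse syndrome between two sparse syndromes. -/
theorem Topological.localizedOn_of_sparse (hH : H.Topological ℓ α) {ξ Ξ : ℕ} (hξ : 1 ≤ ξ)
    (hΞ : 1200 * (α * ξ) ≤ Ξ) (hfit : (Ξ : ℝ) ≤ ℓ) {Y : Fin 3 → Finset (Fin H.M)}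
    (hY : ∀ i, H.Sparse ξ Ξ (Y i)) {E : H.Op}
    (hE : ∀ u ∈ support E, ∃ i, u ∈ H.near (71 * (α * ξ)) (Y i))
    (hsynd : H.syndrome E ⊆ Y 0 ∪ Y 1) :
    H.LocalizedOn (H.near (71 * (α * ξ)) (Y 0 ∪ Y 1)) E := by
  have hα := hH.one_le
  refine H.localizedOn_of_indecomposable (W := {u | ∃ i, u ∈ H.near (71 * (α * ξ)) (Y i)})
    (X := Y 0 ∪ Y 1) ?_ E hE hsynd
  clear hE hsynd E
  intro E hE hsynd hK
  set m := α * ξ with hm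
  have hξm : ξ ≤ m := Nat.le_mul_of_pos_left _ hα
  rcases (support E).eq_empty_or_nonempty with h0 | ⟨u₀, hu₀⟩
  · rw [H.eq_zero_of_support_eq_empty h0]
    exact localizedOn_of_mem_stabilizers (zero_mem _)
  -- The radius is at most `441 * m`. Both `2 * 441 * m + 142 * m` here and `2 * (441 * m + 1 + 71 *
  -- m)` in the final fit stay below `1200 * m`.
  have hball := hK.subset_ball H hu₀ hY (fun u hu _ => hE hu) (by omega)
  have hclose : ∀ i, ∀ a ∈ H.syndrome E ∩ Y i, ∀ b ∈ H.syndrome E ∩ Y i,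
      torusDist (H.loc a) (H.loc b) ≤ 4 * ξ := by
    intro i a ha b hb
    rw [Finset.mem_inter] at ha hb
    obtain ⟨u, hu, hua⟩ := H.exists_support_of_mem_syndrome ha.1
    obtain ⟨v, hv, hvb⟩ := H.exists_support_of_mem_syndrome hb.1
    refine (hY i a ha.2 b hb.2).resolve_right ?_
    have h1 := mem_ball.1 (hball hu)
    have h2 := mem_ball.1 (hball hv)
    have h3 := H.torusDist_loc_le hua
    have h4 := H.torusDist_loc_le hvb
    have h5 := torusDist_triangle (H.loc a) u (H.loc b)
    have h6 := torusDist_triangle u u₀ (H.loc b)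
    have h7 := torusDist_triangle u₀ v (H.loc b)
    rw [torusDist_comm] at h3
    rw [torusDist_comm] at h2
    omega
  refine (hH.localizedOn_near_syndrome hξ hball (C₁ := H.syndrome E ∩ Y 0)
    (C₂ := H.syndrome E ∩ Y 1) ?_ (hclose 0) (hclose 1) (le_trans ?_ hfit)).mono
    (H.near_mono le_rfl hsynd)
  · rw [← Finset.inter_union_distrib_left, Finset.inter_eq_left.2 hsynd]
  · exact_mod_cast (by omega : _ ≤ Ξ)

/-- Elimination of intermediate sparse syndromes between two arbitrary syndromes. -/
theorem Topological.localizedOn_of_sparse' (hH : H.Topological ℓ α) {ξ Ξ : ℕ} (hξ : 1 ≤ ξ)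
    (hΞ : 1200 * (α * ξ) ≤ Ξ) (hfit : (Ξ : ℝ) ≤ ℓ) {X : Finset (Fin H.M)}
    {Y : Fin 3 → Finset (Fin H.M)}
    (hY : ∀ i, H.Sparse ξ Ξ (Y i)) {E : H.Op}
    (hE : ∀ u ∈ support E, u ∈ H.near (71 * (α * ξ)) X ∨ ∃ i, u ∈ H.near (71 * (α * ξ)) (Y i))
    (hsynd : H.syndrome E ⊆ X) :
    H.LocalizedOn (H.near Ξ X) E := by
  have hα := hH.one_le
  refine H.localizedOn_of_indecomposable (W := {u | u ∈ H.near (71 * (α * ξ)) X ∨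
    ∃ i, u ∈ H.near (71 * (α * ξ)) (Y i)}) (X := X) ?_ E hE hsynd
  clear hE hsynd E
  intro E hE hsynd hK
  set m := α * ξ with hm
  have hξm : ξ ≤ m := Nat.le_mul_of_pos_left _ hα
  -- If some ball of this radius sees no part of the support near `X`, the whole piece lies in it,
  -- carries no defect, and is a stabilizer by TQO1. Otherwise every point of the piece is already
  -- within `Ξ` of `X`.
  by_cases h : ∃ u₀ ∈ support E, ∀ u ∈ support E, u ∈ ball u₀ (3 * (4 * ξ + 2 * (71 * m) + 1)) →
      u ∉ H.near (71 * m) X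
  · obtain ⟨u₀, hu₀, h⟩ := h
    have hball := hK.subset_ball H hu₀ hY (fun u hu h1 => (hE hu).resolve_left (h u hu h1))
      (by omega)
    refine localizedOn_of_mem_stabilizers (hH.mem_stabilizers hball (le_trans ?_ hfit) ?_)
    · exact_mod_cast (by omega : _ ≤ Ξ)
    · rw [Finset.eq_empty_iff_forall_notMem]
      intro a ha
      obtain ⟨u, hu, hua⟩ := H.exists_support_of_mem_syndrome ha
      refine h u hu (hball hu) ⟨a, hsynd ha, (H.torusDist_loc_le hua).trans (by omega)⟩
  · push Not at h
    refine ⟨E, by simp, fun u hu => ?_⟩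
    obtain ⟨v, -, hvu, a, ha, hva⟩ := h u hu
    refine ⟨a, ha, ?_⟩
    have h1 := torusDist_triangle u v (H.loc a)
    rw [mem_ball, torusDist_comm] at hvu
    omega

end StabilizerHamiltonian

/-! ### Renormalization of the error path -/

namespace StabilizerHamiltonian

variable {D L : ℕ} [NeZero L] {H : StabilizerHamiltonian D L} {ℓ : ℝ} {α : ℕ}

theorem syndrome_sub_subset (E F : H.Op) : H.syndrome (E - F) ⊆ H.syndrome E ∪ H.syndrome F := by
  rw [sub_eq_add_neg, H.op_neg]
  exact H.syndrome_add_subset E F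

theorem LocalizedOn.trans {W Z : Set (Lattice D L)} {E : H.Op} (hE : H.LocalizedOn W E)
    (h : ∀ F : H.Op, support F ⊆ W → H.syndrome F = H.syndrome E → H.LocalizedOn Z F) :
    H.LocalizedOn Z E := by
  obtain ⟨F, h1, h2⟩ := hE
  exact LocalizedOn.of_sub_mem h1 (h F h2 (H.syndrome_eq_of_flip_eq (H.flip_eq_of_sub_mem h1).symm))

variable (H) in
/-- The syndrome `S` is sparse at the length scale `(1200 * α) ^ p`. -/
def SparseAt (α p : ℕ) (S : Finset (Fin H.M)) : Prop :=
  H.Sparse ((1200 * α) ^ p) ((1200 * α) ^ (p + 1)) S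

/-- A single-qubit error is localized near the defects it creates. -/
theorem Topological.localizedOn_of_isSingleQubit (hH : H.Topological ℓ α) (hℓ : 0 ≤ ℓ)
    {E : H.Op} (hE : IsSingleQubit E) : H.LocalizedOn (H.near 1 (H.syndrome E)) E := by
  obtain ⟨q, p, -, rfl⟩ := hE
  have hsupp : support (Pi.single q p : H.Op) ⊆ {q.1} := by
    rintro u ⟨k, hk⟩
    by_contra h
    have hne : (⟨u, k⟩ : Qubit H.numQubits) ≠ q := by
      rintro rfl
      exact h rfl
    exact hk (Pi.single_eq_of_ne (M := fun _ => ZMod 2 × ZMod 2) hne p)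
  rcases (H.syndrome (Pi.single q p : H.Op)).eq_empty_or_nonempty with h | ⟨a, ha⟩
  · refine localizedOn_of_mem_stabilizers (hH.mem_stabilizers (x := q.1) (ρ := 0) ?_ ?_ h)
    · intro u hu
      rw [hsupp hu, mem_ball, torusDist_self]
    · simpa using hℓ
  · refine ⟨Pi.single q p, by rw [sub_self]; exact zero_mem _, fun u hu => ⟨a, ha, ?_⟩⟩
    obtain ⟨v, hv, hva⟩ := H.exists_support_of_mem_syndrome ha
    rw [hsupp hu, ← hsupp hv]
    exact H.torusDist_loc_le hva

/-- A path all of whose intermediate syndromes are sparse below level `p` is localized, at the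
corresponding length scale, near its initial and final syndromes. -/
theorem Topological.localizedOn_path (hH : H.Topological ℓ α) {U : ℕ → H.Op}
    (hU : ∀ t, IsSingleQubit (U (t + 1) - U t) ∨ U (t + 1) = U t) (p : ℕ)
    (hfit : (((1200 * α) ^ p : ℕ) : ℝ) ≤ ℓ) {s t : ℕ} (hst : s < t)
    (hsparse : ∀ u, s < u → u < t → ∃ q < p, H.SparseAt α q (H.syndrome (U u))) :
    H.LocalizedOn (H.near ((1200 * α) ^ p) (H.syndrome (U s) ∪ H.syndrome (U t))) (U t - U s) := by
  classical
  have hα := hH.one_le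
  induction p generalizing s t with
  | zero =>
    have ht : t = s + 1 := by
      by_contra h
      obtain ⟨q, hq, -⟩ := hsparse (s + 1) (by omega) (by omega)
      omega
    subst ht
    rcases hU s with h | h
    · refine (hH.localizedOn_of_isSingleQubit ?_ h).mono (H.near_mono (by simp) ?_)
      · exact le_trans (Nat.cast_nonneg _) hfit
      · rw [Finset.union_comm]
        exact syndrome_sub_subset _ _
    · rw [h, sub_self]
      exact localizedOn_of_mem_stabilizers (zero_mem _)
  | succ p ih =>
    set ξ := (1200 * α) ^ p with hξ
    have hξ1 : 1 ≤ ξ := Nat.one_le_pow _ _ (by omega)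
    have hΞ : (1200 * α) ^ (p + 1) = 1200 * (α * ξ) := by
      rw [pow_succ, ← hξ]
      ring
    have hξα : ξ ≤ α * ξ := Nat.le_mul_of_pos_left _ hα
    have hfit' : (ξ : ℝ) ≤ ℓ := by
      refine le_trans ?_ hfit
      rw [hΞ]
      exact_mod_cast (by omega)
    replace ih := fun {s t : ℕ} => ih (s := s) (t := t) hfit'
    -- the intermediate times that survive the elimination of the levels below `p`
    set F := (Finset.range t).filter fun u =>
      s < u ∧ ¬ ∃ q < p, H.SparseAt α q (H.syndrome (U u)) with hF
    have hmem : ∀ u, u ∈ F ↔ u < t ∧ s < u ∧ ¬ ∃ q < p, H.SparseAt α q (H.syndrome (U u)) := by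
      intro u
      rw [hF, Finset.mem_filter, Finset.mem_range]
    have hgood : ∀ u ∈ F, H.Sparse ξ ((1200 * α) ^ (p + 1)) (H.syndrome (U u)) := by
      intro u hu
      rw [hmem] at hu
      obtain ⟨q, hq, h⟩ := hsparse u hu.2.1 hu.1
      have : q = p := by
        by_contra hne
        exact hu.2.2 ⟨q, by omega, h⟩
      rw [this] at h
      exact h
    have hbad : ∀ u, s < u → u < t → u ∉ F → ∃ q < p, H.SparseAt α q (H.syndrome (U u)) := by
      intro u h1 h2 h3
      by_contra h4
      exact h3 ((hmem u).2 ⟨h2, h1, h4⟩)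
    rcases F.eq_empty_or_nonempty with hF0 | hF0
    · refine (ih hst fun u h1 h2 => hbad u h1 h2 (by simp [hF0])).mono
        (H.near_mono ?_ subset_rfl)
      omega
    set s₁ := F.min' hF0 with hs₁
    set t₁ := F.max' hF0 with ht₁
    have hs₁F : s₁ ∈ F := F.min'_mem hF0
    have ht₁F : t₁ ∈ F := F.max'_mem hF0
    have hs₁b := (hmem _).1 hs₁F
    have ht₁b := (hmem _).1 ht₁F
    -- The radius `71 * (α * ξ)` is restored at each surviving time: append the segment from the
    -- previous surviving time `v`, localized by the outer induction, then eliminate the syndrome at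
    -- `v`.
    have hmid : ∀ u ∈ F, H.LocalizedOn (H.near (71 * (α * ξ))
        (H.syndrome (U s₁) ∪ H.syndrome (U u))) (U u - U s₁) := by
      intro u
      induction u using Nat.strong_induction_on with
      | _ u ihu =>
        intro hu
        have hub := (hmem _).1 hu
        rcases (F.min'_le u hu).eq_or_lt with h | h
        · rw [← h, ← hs₁, sub_self]
          exact localizedOn_of_mem_stabilizers (zero_mem _)
        have hne : (F.filter (· < u)).Nonempty := ⟨s₁, Finset.mem_filter.2 ⟨hs₁F, h⟩⟩
        set v := (F.filter (· < u)).max' hne with hv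
        have hvF := Finset.mem_filter.1 ((F.filter (· < u)).max'_mem hne)
        rw [← hv] at hvF
        have hvb := (hmem _).1 hvF.1
        have h1 := ihu v hvF.2 hvF.1
        have h2 := ih hvF.2 fun y hy1 hy2 => hbad y (by omega) (by omega) fun hyF => by
          have := (F.filter (· < u)).le_max' y (Finset.mem_filter.2 ⟨hyF, hy2⟩)
          omega
        set Y : Fin 3 → Finset (Fin H.M) :=
          ![H.syndrome (U s₁), H.syndrome (U u), H.syndrome (U v)] with hY
        set W : Set (Lattice D L) := {x | ∃ i, x ∈ H.near (71 * (α * ξ)) (Y i)} with hW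
        have hW1 : H.near (71 * (α * ξ)) (H.syndrome (U s₁) ∪ H.syndrome (U v)) ⊆ W := by
          rintro x ⟨a, ha, hx⟩
          rcases Finset.mem_union.1 ha with ha | ha
          · exact ⟨0, a, ha, hx⟩
          · exact ⟨2, a, ha, hx⟩
        have hW2 : H.near ξ (H.syndrome (U v) ∪ H.syndrome (U u)) ⊆ W := by
          rintro x ⟨a, ha, hx⟩
          rcases Finset.mem_union.1 ha with ha | ha
          · exact ⟨2, a, ha, hx.trans (by omega)⟩
          · exact ⟨1, a, ha, hx.trans (by omega)⟩
        have h3 := (h1.mono hW1).add (h2.mono hW2)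
        rw [add_comm, sub_add_sub_cancel] at h3
        refine h3.trans fun E hE hEs => ?_
        refine hH.localizedOn_of_sparse hξ1 hΞ.ge hfit (Y := Y) ?_ hE ?_
        · intro i
          fin_cases i
          · exact hgood _ hs₁F
          · exact hgood _ hu
          · exact hgood _ hvF.1
        · rw [hEs]
          refine (syndrome_sub_subset _ _).trans ?_
          rw [Finset.union_comm]
          exact subset_rfl
    have h1 := ih hs₁b.2.1 fun y hy1 hy2 => hbad y hy1 (by omega) fun hyF => by
      have := F.min'_le y hyF
      omega
    have h2 := hmid t₁ ht₁F
    have h3 := ih ht₁b.1 fun y hy1 hy2 => hbad y (by omega) hy2 fun hyF => by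
      have := F.le_max' y hyF
      omega
    -- The end syndromes at `s` and `t` need not be sparse, so they go into `X`. Only two sparse
    -- syndromes remain to be eliminated, and `∅` fills the third slot.
    set Y : Fin 3 → Finset (Fin H.M) := ![H.syndrome (U s₁), H.syndrome (U t₁), ∅] with hY
    set X := H.syndrome (U s) ∪ H.syndrome (U t) with hX
    set W : Set (Lattice D L) := {x | x ∈ H.near (71 * (α * ξ)) X ∨
      ∃ i, x ∈ H.near (71 * (α * ξ)) (Y i)} with hW
    have hW1 : H.near ξ (H.syndrome (U s) ∪ H.syndrome (U s₁)) ⊆ W := by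
      rintro x ⟨a, ha, hx⟩
      rcases Finset.mem_union.1 ha with ha | ha
      · exact Or.inl ⟨a, Finset.mem_union_left _ ha, hx.trans (by omega)⟩
      · exact Or.inr ⟨0, a, ha, hx.trans (by omega)⟩
    have hW2 : H.near (71 * (α * ξ)) (H.syndrome (U s₁) ∪ H.syndrome (U t₁)) ⊆ W := by
      rintro x ⟨a, ha, hx⟩
      rcases Finset.mem_union.1 ha with ha | ha
      · exact Or.inr ⟨0, a, ha, hx⟩
      · exact Or.inr ⟨1, a, ha, hx⟩
    have hW3 : H.near ξ (H.syndrome (U t₁) ∪ H.syndrome (U t)) ⊆ W := by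
      rintro x ⟨a, ha, hx⟩
      rcases Finset.mem_union.1 ha with ha | ha
      · exact Or.inr ⟨1, a, ha, hx.trans (by omega)⟩
      · exact Or.inl ⟨a, Finset.mem_union_right _ ha, hx.trans (by omega)⟩
    have h4 := (h3.mono hW3).add ((h2.mono hW2).add (h1.mono hW1))
    rw [sub_add_sub_cancel, sub_add_sub_cancel] at h4
    refine h4.trans fun E hE hEs => ?_
    refine hH.localizedOn_of_sparse' hξ1 hΞ.ge hfit (Y := Y) ?_ hE ?_
    · intro i
      fin_cases i
      · exact hgood _ hs₁F
      · exact hgood _ ht₁F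
      · intro a ha
        simp [hY] at ha
    · rw [hEs]
      refine (syndrome_sub_subset _ _).trans ?_
      rw [Finset.union_comm]

/-! ### Few defects imply sparsity at some level -/

/-- If `S` is not sparse at the first `p` levels, then its defects can be merged `p` times. -/
theorem exists_merging_of_not_sparseAt (hα : 1 ≤ α) {S : Finset (Fin H.M)} (p : ℕ)
    (h : ∀ q < p, ¬ H.SparseAt α q S) :
    ∃ f : Fin H.M → Fin H.M, (∀ a ∈ S, f a ∈ S ∧
      torusDist (H.loc a) (H.loc (f a)) ≤ 2 * (1200 * α) ^ p) ∧ (S.image f).card + p ≤ S.card := by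
  induction p with
  | zero => exact ⟨id, fun a ha => ⟨ha, by simp [torusDist_self]⟩, by simp⟩
  | succ p ih =>
    obtain ⟨f, hf, hcard⟩ := ih fun q hq => h q (by omega)
    have hp := h p (by omega)
    have hξ : 1200 * (1200 * α) ^ p ≤ (1200 * α) ^ (p + 1) := by
      rw [pow_succ, mul_comm]
      exact Nat.mul_le_mul_left _ (by omega)
    unfold SparseAt Sparse at hp
    push Not at hp
    obtain ⟨a, ha, b, hb, h1, h2⟩ := hp
    -- A common image would put `a` and `b` within `4 * (1200 * α) ^ p`, twice the displacement
    -- bound. This is why `Sparse` has the factor `4`.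
    have hne : f a ≠ f b := by
      intro hab
      have h3 := (hf a ha).2
      have h4 := (hf b hb).2
      rw [← hab, torusDist_comm] at h4
      have h5 := torusDist_triangle (H.loc a) (H.loc (f a)) (H.loc b)
      omega
    -- Redirecting the class of `a` to `f b` loses the image point `f a`. A defect moves at most
    -- three old displacements plus the distance from `a` to `b`, below twice the new scale.
    refine ⟨fun x => if f x = f a then f b else f x, fun x hx => ?_, ?_⟩
    · dsimp only
      have h3 := hf x hx
      by_cases hxa : f x = f a
      · rw [if_pos hxa]
        refine ⟨(hf b hb).1, ?_⟩
        have h4 := (hf a ha).2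
        have h5 := (hf b hb).2
        have h6 := torusDist_triangle (H.loc x) (H.loc (f x)) (H.loc (f b))
        have h7 := torusDist_triangle (H.loc (f x)) (H.loc a) (H.loc (f b))
        have h8 := torusDist_triangle (H.loc a) (H.loc b) (H.loc (f b))
        rw [hxa] at h3 h6 h7
        rw [torusDist_comm (H.loc (f a)) (H.loc a)] at h7
        omega
      · rw [if_neg hxa]
        exact ⟨h3.1, by omega⟩
    · have hlt : (S.image fun x => if f x = f a then f b else f x).card < (S.image f).card := by
        refine Finset.card_lt_card ((Finset.ssubset_iff_of_subset ?_).2 ⟨f a, ?_, ?_⟩)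
        · intro y hy
          obtain ⟨x, hx, rfl⟩ := Finset.mem_image.1 hy
          split_ifs
          · exact Finset.mem_image_of_mem f hb
          · exact Finset.mem_image_of_mem f hx
        · exact Finset.mem_image_of_mem f ha
        · intro hy
          obtain ⟨x, hx, hxa⟩ := Finset.mem_image.1 hy
          split_ifs at hxa with h3
          · exact hne hxa.symm
          · exact h3 hxa
      omega

/-- Failure at all `n` levels would merge the defects down to nothing, yet the empty syndrome is
sparse. -/
theorem exists_sparseAt (hα : 1 ≤ α) {S : Finset (Fin H.M)} {n : ℕ} (hn : 1 ≤ n)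
    (hS : S.card ≤ n) : ∃ q < n, H.SparseAt α q S := by
  by_contra! h
  obtain ⟨f, -, hcard⟩ := exists_merging_of_not_sparseAt hα n h
  have h0 : S = ∅ := by
    rw [← Finset.image_eq_empty (f := f), ← Finset.card_eq_zero]
    omega
  refine h 0 hn ?_
  rw [h0]
  intro a ha
  simp at ha

end StabilizerHamiltonian

/-! ### From localization to energy barriers -/

namespace StabilizerHamiltonian

variable {D L : ℕ} [NeZero L] {H : StabilizerHamiltonian D L} {ℓ : ℝ} {α : ℕ}

theorem near_empty (r : ℕ) : H.near r ∅ = ∅ := by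
  ext u
  simp [near]

theorem LocalizedOn.mem_stabilizers {E : H.Op} (h : H.LocalizedOn ∅ E) : E ∈ H.stabilizers := by
  obtain ⟨F, h1, h2⟩ := h
  rwa [H.eq_zero_of_support_eq_empty (Set.subset_empty_iff.1 h2), sub_zero] at h1

theorem IsErrorPath.step {errs : List H.Op} (h : H.IsErrorPath errs) (t : ℕ) :
    IsSingleQubit ((errs.take (t + 1)).sum - (errs.take t).sum) ∨
      (errs.take (t + 1)).sum = (errs.take t).sum := by
  rcases lt_or_ge t errs.length with ht | ht
  · left
    rw [List.sum_take_succ errs t ht, add_sub_cancel_left]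
    exact h _ (List.getElem_mem ht)
  · right
    rw [List.take_of_length_le ht, List.take_of_length_le (by omega)]

theorem card_le_floor_of_not_exceeds {errs : List H.Op} {ω : ℝ} (h : ¬ H.Exceeds errs ω) (t : ℕ) :
    (H.syndrome (errs.take t).sum).card ≤ ⌊ω⌋₊ := by
  unfold Exceeds at h
  push Not at h
  rcases le_total t errs.length with ht | ht
  · exact Nat.le_floor (h t ht)
  · have := h errs.length le_rfl
    rw [List.take_of_length_le ht]
    rw [List.take_length] at this
    exact Nat.le_floor this

/-- The product of a path with few defects is localized near the final syndrome. -/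
theorem Topological.localizedOn_of_errorPath (hH : H.Topological ℓ α) {errs : List H.Op}
    (herrs : H.IsErrorPath errs) {n : ℕ} (hn : 1 ≤ n)
    (hcard : ∀ t, (H.syndrome (errs.take t).sum).card ≤ n)
    (hfit : (((1200 * α) ^ n : ℕ) : ℝ) ≤ ℓ) :
    H.LocalizedOn (H.near ((1200 * α) ^ n) (H.syndrome errs.sum)) errs.sum := by
  rcases Nat.eq_zero_or_pos errs.length with h0 | h0
  · rw [List.length_eq_zero_iff] at h0
    subst h0
    exact localizedOn_of_mem_stabilizers (zero_mem _)
  · have := hH.localizedOn_path (U := fun t => (errs.take t).sum) herrs.step n hfit h0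
      fun u _ _ => exists_sparseAt hH.one_le hn (hcard u)
    simpa [H.syndrome_zero] using this

/-- The case of zero defects, where `exists_sparseAt` offers no level: each single error has empty
syndrome and is itself a stabilizer. -/
theorem Topological.sum_mem_stabilizers_of_syndrome_eq_empty (hH : H.Topological ℓ α)
    (hℓ : 0 ≤ ℓ) {errs : List H.Op} (herrs : H.IsErrorPath errs)
    (h : ∀ t, H.syndrome (errs.take t).sum = ∅) : errs.sum ∈ H.stabilizers := by
  have key : ∀ t, (errs.take t).sum ∈ H.stabilizers := by
    intro t
    induction t with
    | zero => simp
    | succ t ih =>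
      rcases herrs.step t with h1 | h1
      · have h2 := hH.localizedOn_of_isSingleQubit hℓ h1
        have h3 : H.syndrome ((errs.take (t + 1)).sum - (errs.take t).sum) = ∅ := by
          rw [← Finset.subset_empty]
          exact (syndrome_sub_subset _ _).trans (by rw [h, h, Finset.union_empty])
        rw [h3, near_empty] at h2
        have := add_mem h2.mem_stabilizers ih
        rwa [sub_add_cancel] at this
      · rwa [h1]
  have := key errs.length
  rwa [List.take_length] at this

/-- A path with few defects that returns to the vacuum implements a stabilizer. -/
theorem Topological.sum_mem_stabilizers (hH : H.Topological ℓ α) {errs : List H.Op}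
    (herrs : H.IsErrorPath errs) {n : ℕ}
    (hcard : ∀ t, (H.syndrome (errs.take t).sum).card ≤ n)
    (hfit : (((1200 * α) ^ n : ℕ) : ℝ) ≤ ℓ) (hsynd : H.syndrome errs.sum = ∅) :
    errs.sum ∈ H.stabilizers := by
  rcases Nat.eq_zero_or_pos n with rfl | hn
  · refine hH.sum_mem_stabilizers_of_syndrome_eq_empty (le_trans (Nat.cast_nonneg _) hfit) herrs
      fun t => ?_
    simpa using hcard t
  · have h1 := hH.localizedOn_of_errorPath herrs hn hcard hfit
    rw [hsynd, near_empty] at h1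
    exact h1.mem_stabilizers

theorem neutral_empty : H.Neutral ℓ ∅ :=
  ⟨0, ⟨0, by simp [H.support_zero]⟩, H.syndrome_zero⟩

/-- An isolated part of a syndrome created near its defects is neutral. -/
theorem neutral_of_isIsolated {E : H.Op} {S' : Finset (Fin H.M)} {ξ : ℕ} {r R : ℝ}
    {x : Lattice D L} (hξ : 1 ≤ ξ) (hE : support E ⊆ H.near ξ (H.syndrome E))
    (hS' : S' ⊆ H.syndrome E) (hx : H.region S' ⊆ cube x r)
    (hR : H.IsIsolated (H.syndrome E) S' R) (hξR : ((5 * ξ : ℕ) : ℝ) ≤ R) (hℓ : r + R < ℓ) :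
    H.Neutral ℓ S' := by
  have hfar : ∀ a ∈ S', ∀ b ∈ H.syndrome E, b ∉ S' →
      5 * ξ < torusDist (H.loc a) (H.loc b) := by
    intro a ha b hb hb'
    have := hR _ (Set.mem_biUnion ha (loc_mem_cube a)) _
      (Set.mem_biUnion (Finset.mem_sdiff.2 ⟨hb, hb'⟩) (loc_mem_cube b))
    exact_mod_cast hξR.trans_lt this
  have hsep : ∀ u ∈ support E, u ∈ H.near ξ S' → ∀ v ∈ support E, v ∉ H.near ξ S' →
      1 < torusDist u v := by
    rintro u hu ⟨a, ha, hua⟩ v hv hvS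
    obtain ⟨b, hb, hvb⟩ := hE hv
    have h1 := hfar a ha b hb fun hb' => hvS ⟨b, hb', hvb⟩
    have h2 := torusDist_triangle (H.loc a) u (H.loc b)
    have h3 := torusDist_triangle u v (H.loc b)
    rw [torusDist_comm] at hua
    omega
  -- The neighborhood fits in a cube of size `r + 2 * ξ ≤ r + R < ℓ`, and isolation keeps it apart
  -- from the rest of the support.
  refine ⟨H.restrict (H.near ξ S') E, ⟨fun i => x i - (ξ : ZMod L), ?_⟩, ?_⟩
  · rw [H.support_restrict]
    rintro u ⟨-, a, ha, hua⟩
    refine cube_mono ?_ (mem_cube_of_torusDist_le (hx (Set.mem_biUnion ha (loc_mem_cube a))) hua)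
    push_cast at hξR
    have : (0 : ℝ) ≤ ξ := Nat.cast_nonneg _
    linarith
  · ext a
    constructor
    · intro ha
      obtain ⟨u, hu, hua⟩ := H.exists_support_of_mem_syndrome ha
      rw [support_restrict] at hu
      obtain ⟨b, hb, hub⟩ := hu.2
      by_contra ha'
      have h1 := hfar b hb a (H.syndrome_restrict_subset hsep ha) ha'
      have h2 := H.torusDist_loc_le hua
      have h3 := torusDist_triangle (H.loc b) u (H.loc a)
      rw [torusDist_comm] at hub
      omega
    · intro ha
      obtain ⟨u, hu, hua⟩ := H.exists_support_of_mem_syndrome (hS' ha)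
      have huS : u ∈ H.near ξ S' := ⟨a, ha, (H.torusDist_loc_le hua).trans hξ⟩
      rw [mem_syndrome, H.flip_restrict_eq hsep hu huS hua, ← mem_syndrome]
      exact hS' ha

theorem topological_ceil {α : ℝ} (hα : 1 ≤ α) (h1 : H.TQO1 ℓ) (h2 : H.TQO2 ℓ)
    (h3 : H.NoStringsRule ℓ α) : H.Topological ℓ ⌈α⌉₊ where
  one_le := Nat.one_le_ceil_iff.2 (by linarith)
  tqo1 := h1
  tqo2 := h2
  noStrings w c₁ c₂ E hE hE' := by
    obtain ⟨u, hu, v, hv, huv⟩ := h3 w c₁ c₂ E hE hE'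
    exact ⟨u, hu, v, hv, huv.trans (mul_le_mul_of_nonneg_right (Nat.le_ceil α) (Nat.cast_nonneg w))⟩

end StabilizerHamiltonian

theorem pow_le_of_mul_log_le {n : ℕ} {k x : ℝ} (hk : 0 < k) (hx : 0 < x)
    (h : n * Real.log k ≤ Real.log x) : k ^ n ≤ x := by
  rw [← Real.log_le_log_iff (pow_pos hk n) hx, Real.log_pow]
  exact h

theorem floor_mul_le {s y l : ℝ} (hl : 0 < l) (hy : 0 ≤ s * y) : (⌊s / l * y⌋₊ : ℝ) * l ≤ s * y := by
  have h1 : (⌊s / l * y⌋₊ : ℝ) ≤ s / l * y := Nat.floor_le (by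
    rw [div_mul_eq_mul_div]
    positivity)
  calc (⌊s / l * y⌋₊ : ℝ) * l ≤ s / l * y * l := mul_le_mul_of_nonneg_right h1 hl.le
    _ = s * y := by field_simp

end NoStrings
end

/-! ### The two logarithmic barriers -/

theorem mainTheorem7 :
    -- logical operators: the constant depends only on `α` and `γ`
    (∀ α γ : ℝ, 1 ≤ α → 0 < γ → γ ≤ 1 →
      ∃ c : ℝ, 0 < c ∧
        ∀ (D L : ℕ) [NeZero L] (H : NoStrings.StabilizerHamiltonian D L) (Ltqo : ℝ),
          (L : ℝ) ^ γ ≤ Ltqo → H.TQO1 Ltqo → H.TQO2 Ltqo → H.NoStringsRule Ltqo α →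
          ∀ P : H.Op, H.IsLogical P → H.LogicalHasBarrier P (c * Real.log L)) ∧
    -- isolated charged clusters: the constant depends only on `α`
    (∀ α : ℝ, 1 ≤ α →
      ∃ c : ℝ, 0 < c ∧
        ∀ (D L : ℕ) [NeZero L] (H : NoStrings.StabilizerHamiltonian D L) (Ltqo : ℝ),
          H.TQO1 Ltqo → H.TQO2 Ltqo → H.NoStringsRule Ltqo α →
          ∀ (S S' : Finset (Fin H.M)) (r R : ℝ),
            H.Neutral Ltqo S → S' ⊆ S → ¬ H.Neutral Ltqo S' →
            (∃ x, H.region S' ⊆ NoStrings.cube x r) → 0 < R → H.IsIsolated S S' R →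
            r + R < Ltqo →
            H.SyndromeHasBarrier S (c * Real.log R)) := by
  have hceil : ∀ {α : ℝ}, 1 ≤ α → (1 : ℝ) ≤ (⌈α⌉₊ : ℝ) := fun h => h.trans (Nat.le_ceil _)
  constructor
  · intro α γ hα hγ _
    have hα' := hceil hα
    have hlog : 0 < Real.log (1200 * (⌈α⌉₊ : ℝ)) := Real.log_pos (by linarith)
    -- Chosen so that `n = ⌊c * log L⌋₊` defects give `(1200 * ⌈α⌉₊) ^ n ≤ L ^ γ`.
    refine ⟨γ / Real.log (1200 * (⌈α⌉₊ : ℝ)), div_pos hγ hlog, ?_⟩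
    intro D L _ H Ltqo hL h1 h2 h3 P hP errs herrs hstab
    by_contra hex
    have hH := NoStrings.StabilizerHamiltonian.topological_ceil hα h1 h2 h3
    have hL1 : (1 : ℝ) ≤ L := by exact_mod_cast Nat.one_le_iff_ne_zero.2 (NeZero.ne L)
    have hpow : (1200 * (⌈α⌉₊ : ℝ)) ^ ⌊γ / Real.log (1200 * (⌈α⌉₊ : ℝ)) * Real.log L⌋₊
        ≤ (L : ℝ) ^ γ := by
      refine NoStrings.pow_le_of_mul_log_le (by linarith) (Real.rpow_pos_of_pos (by linarith) _) ?_
      rw [Real.log_rpow (by linarith)]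
      exact NoStrings.floor_mul_le hlog (mul_nonneg hγ.le (Real.log_nonneg hL1))
    have hsum : errs.sum ∈ H.stabilizers := by
      refine hH.sum_mem_stabilizers herrs
        (NoStrings.StabilizerHamiltonian.card_le_floor_of_not_exceeds hex) ?_ ?_
      · push_cast
        exact hpow.trans hL
      · rw [H.syndrome_eq_empty_iff]
        have h4 := H.flip_eq_zero_of_mem_stabilizers hstab
        rwa [map_add, H.syndrome_eq_empty_iff.1 hP.1, add_zero] at h4
    refine hP.2 ?_
    have h5 := sub_mem (H.mem_stabilizers.2 hstab) hsum
    rwa [add_sub_cancel_left] at h5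
  · intro α hα
    have hα' := hceil hα
    -- Here `6000 = 5 * 1200`: as `n ≥ 1`, the isolation factor `5` is absorbed into `5 ^ n`.
    have hlog : 0 < Real.log (6000 * (⌈α⌉₊ : ℝ)) := Real.log_pos (by linarith)
    refine ⟨1 / Real.log (6000 * (⌈α⌉₊ : ℝ)), div_pos one_pos hlog, ?_⟩
    rintro D L _ H Ltqo h1 h2 h3 S S' r R hS hS' hcharged ⟨x, hx⟩ hR hiso hrR errs herrs rfl
    by_contra hex
    have hH := NoStrings.StabilizerHamiltonian.topological_ceil hα h1 h2 h3
    have hcard := NoStrings.StabilizerHamiltonian.card_le_floor_of_not_exceeds hex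
    obtain ⟨a, ha⟩ : S'.Nonempty := by
      rw [Finset.nonempty_iff_ne_empty]
      rintro rfl
      exact hcharged NoStrings.StabilizerHamiltonian.neutral_empty
    set n := ⌊1 / Real.log (6000 * (⌈α⌉₊ : ℝ)) * Real.log R⌋₊ with hn
    -- A charged cluster is nonempty, so the final syndrome already has a defect. This also rules
    -- out `log R < 0`.
    have hn1 : 1 ≤ n := by
      have h4 := hcard errs.length
      rw [List.take_length] at h4
      exact (Finset.card_pos.2 ⟨a, hS' ha⟩).trans_le h4
    have hlogR : 0 ≤ 1 * Real.log R := by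
      rw [one_mul]
      by_contra! hneg
      have : n = 0 := Nat.floor_of_nonpos
        (mul_nonpos_of_nonneg_of_nonpos (div_pos one_pos hlog).le hneg.le)
      omega
    have hpow : (6000 * (⌈α⌉₊ : ℝ)) ^ n ≤ R := by
      refine NoStrings.pow_le_of_mul_log_le (by linarith) hR ?_
      have := NoStrings.floor_mul_le hlog hlogR
      rwa [← hn, one_mul] at this
    have hpow5 : ((5 * (1200 * ⌈α⌉₊) ^ n : ℕ) : ℝ) ≤ R := by
      refine le_trans ?_ hpow
      have h5 : (5 : ℝ) ≤ 5 ^ n := le_self_pow₀ (by norm_num) (by omega)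
      have h6 : (6000 * (⌈α⌉₊ : ℝ)) ^ n = 5 ^ n * (1200 * (⌈α⌉₊ : ℝ)) ^ n := by
        rw [← mul_pow]
        ring
      rw [h6]
      push_cast
      exact mul_le_mul_of_nonneg_right h5 (by positivity)
    -- a nonempty cluster fits in a cube of negative size only in dimension zero
    have hr : 0 ≤ r := by
      by_contra! hr
      have hxa := hx (Set.mem_biUnion ha (NoStrings.StabilizerHamiltonian.loc_mem_cube a))
      have hD : IsEmpty (Fin D) :=
        ⟨fun i => absurd ((Nat.cast_nonneg _).trans (hxa i)) (not_le.2 hr)⟩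
      have hsub : H.syndrome errs.sum ⊆ S' := by
        intro b hb
        by_contra hb'
        have := hiso _ (Set.mem_biUnion ha (NoStrings.StabilizerHamiltonian.loc_mem_cube a)) _
          (Set.mem_biUnion (Finset.mem_sdiff.2 ⟨hb, hb'⟩)
            (NoStrings.StabilizerHamiltonian.loc_mem_cube b))
        simp only [NoStrings.torusDist, Finset.univ_eq_empty, Finset.sup_empty, Nat.bot_eq_zero,
          Nat.cast_zero] at this
        linarith
      rw [hsub.antisymm hS'] at hS
      exact hcharged hS
    have hfit : (((1200 * ⌈α⌉₊) ^ n : ℕ) : ℝ) ≤ Ltqo := by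
      have h7 : (((1200 * ⌈α⌉₊) ^ n : ℕ) : ℝ) ≤ ((5 * (1200 * ⌈α⌉₊) ^ n : ℕ) : ℝ) := by
        exact_mod_cast (by omega)
      linarith
    obtain ⟨E, hE, hEsupp⟩ := hH.localizedOn_of_errorPath herrs hn1 hcard hfit
    have hEs := H.syndrome_eq_of_flip_eq (H.flip_eq_of_sub_mem hE)
    rw [hEs] at hEsupp hS' hiso
    refine hcharged (NoStrings.StabilizerHamiltonian.neutral_of_isIsolated ?_ hEsupp hS' hx hiso
      hpow5 hrR)
    exact Nat.one_le_pow _ _ (Nat.mul_pos (by norm_num) hH.one_le)
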